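/- Let $\mathbb{D}$ be the open unit disc in $\mathbb{C}$, and let $$\beta(z,\zeta)=\tfrac12\log\frac{1+|\phi_z(\zeta)|}{1-|\phi_z(\zeta)|},\qquad \phi_z(\zeta)=\frac{z-\zeta}{1-\overline{z}\zeta},\qquad z,\zeta\in\mathbb{D},$$ be the hyperbolic distance. Let $\mathcal{B}$ be the Bloch space of analytic functions $g$ in $\mathbb{D}$ with $\|g\|_{\mathcal{B}}=\sup_{z\in\mathbb{D}}(1-|z|^2)|g'(z)|<\infty$. For $0<p<\infty$ let $H^p$ be the Hardy space of analytic functions $f$ in $\mathbb{D}$ with $\sup_{0<r<1}\int_0^{2\pi}|f(re^{i\theta})|^p\,d\theta<\infty$, and let $H^\infty$ be the space of bounded analytic functions in $\mathbb{D}$. Then there exists a function $g\in\mathcal{B}$ with the following two properties: 1. for every $\varepsilon>0$ there is a constant $C(\varepsilon)>0$ such that $|g(z)-g(\zeta)|\le C(\varepsilon)+\varepsilon\,\beta(z,\zeta)$ for all $z,\zeta\in\mathbb{D}$; 2. for every $0<p\le\infty$, $g$ does not belong to the closure of $H^p\cap\mathcal{B}$ in $\mathcal{B}$ with respect to $\|\cdot\|_{\mathcal{B}}$.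 Moreover, $g$ can be taken to be a lacunary series $g(z)=\sum_{k=1}^\infty a_k z^{n_k}$, $z\in\mathbb{D}$ (that is, the $n_k$ are positive integers and there is $\rho>1$ with $n_{k+1}\ge\rho\, n_k$ for all $k$), whose coefficients $a_k\in\mathbb{C}$ are bounded and do not tend to $0$, and whose exponents satisfy $n_{k+1}/n_k\to\infty$. -/

import Mathlib

open scoped ENNReal

noncomputable section

namespace BlochClosure

/-- The open unit disc of the complex plane. -/
def disc : Set ℂ := Metric.ball (0 : ℂ) 1

/-- The Möbius automorphism `φ_z(ζ) = (z - ζ) / (1 - conj z * ζ)` of the disc. -/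
def moebius (z ζ : ℂ) : ℂ := (z - ζ) / (1 - (starRingEnd ℂ) z * ζ)

/-- The hyperbolic distance of two points of the unit disc (the distance of the length element
`|dz| / (1 - |z|²)`). -/
def hypDist (z ζ : ℂ) : ℝ :=
  1 / 2 * Real.log ((1 + ‖moebius z ζ‖) / (1 - ‖moebius z ζ‖))

/-- The Bloch seminorm `sup_{z ∈ 𝔻} (1 - |z|²) |g'(z)|`, as an extended nonnegative real. -/
def blochSeminorm (g : ℂ → ℂ) : ℝ≥0∞ :=
  ⨆ z ∈ disc, ENNReal.ofReal ((1 - ‖z‖ ^ 2) * ‖deriv g z‖)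

/-- The Bloch space: functions analytic in the unit disc with finite Bloch seminorm. Values outside
the disc play no role. -/
def blochSpace : Set (ℂ → ℂ) :=
  {g | DifferentiableOn ℂ g disc ∧ blochSeminorm g < ∞}

/-- The Hardy space `H^p`, for `0 < p ≤ ∞`: functions analytic in the unit disc that are bounded
there if `p = ∞`, and otherwise have bounded integral means of order `p` on the circles
`|z| = r`, `0 < r < 1`. -/
def hardySpace (p : ℝ≥0∞) : Set (ℂ → ℂ) :=
  {f | DifferentiableOn ℂ f disc ∧
    if p = ∞ then ∃ M : ℝ, ∀ z ∈ disc, ‖f z‖ ≤ M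
    else (⨆ r ∈ Set.Ioo (0 : ℝ) 1,
      ∫⁻ θ in Set.Ioc (0 : ℝ) (2 * Real.pi), ‖f (circleMap 0 r θ)‖ₑ ^ p.toReal) < ∞}

/-- The closure in the Bloch space, with respect to the Bloch seminorm, of a set of functions. -/
def blochClosure (S : Set (ℂ → ℂ)) : Set (ℂ → ℂ) :=
  {g | g ∈ blochSpace ∧
    ∀ ε : ℝ, 0 < ε → ∃ f ∈ S, blochSeminorm (fun z => g z - f z) < ENNReal.ofReal ε}

/-- `g(z) = ∑ a_k z^{n_k}` in the unit disc, with positive integers `n_k` such that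
`n_{k+1} ≥ ρ n_k` for some `ρ > 1` and all `k`. -/
def IsLacunarySeries (a : ℕ → ℂ) (n : ℕ → ℕ) (g : ℂ → ℂ) : Prop :=
  (∀ k, 0 < n k) ∧
  (∃ ρ : ℝ, 1 < ρ ∧ ∀ k, ρ * (n k : ℝ) ≤ (n (k + 1) : ℝ)) ∧
  ∀ z ∈ disc, HasSum (fun k => a k * z ^ n k) (g z)

end BlochClosure

end

namespace BlochClosure

/-! ### Lacunary sequences of exponents -/

section Exponents

variable {n : ℕ → ℕ}

/-! The series is `g(z) = ∑ z ^ n_k` with `n_k = (k + 1)!`.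

Oscillation (`tsum_norm_pow_sub_pow_le`). Let `|z| ≤ |ζ|`, `s = |z - ζ|`, `t = 1 - |ζ|`. The
difference `z ^ n - ζ ^ n` is at most `n s`, `2 / (n t)` and `2`. If `s < t` these bounds sum to
`O(1)` by lacunarity. Otherwise the exponents below `1 / s` or above `1 / t` contribute `O(1)`, and
where the ratios are at least `q` there are at most `1 + log (s / t) / log q` exponents in between.
Since `log (s / t) ≤ 2 β(z, ζ) + log 8`, letting `q` grow makes the coefficient of `β` arbitrarily
small.

Distance to `H^p`. On the circles `|z| = 1 - 1 / n_{k+1}` with `k` large one term dominates `g'`, so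
`(1 - |z|) |g'| ≥ 1/4` on the whole circle (`le_norm_deriv_lacunarySum`). A Bloch function `f`
within `1/8` of `g` then has `(1 - |z|) |f'| ≥ 1/8` there. The function `u = log (1 + |f|²)` is
subharmonic with Laplacian `4 |f'|² / (1 + |f|²)² = 4 |f'|² e^{-2u}`. A discrete form of this
(`logSize_add_le_circleAverage`), averaged over the circle with Jensen's inequality, shows that the
circular mean of `u` grows by a fixed amount from each such circle to the next as long as the means
stay below a bound `B` (`circleAverage_logSize_gain`). For `f ∈ H^p` these means are bounded,
whatever `p` is, and infinitely many equal gains are impossible. -/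

theorem pow_mul_le_of_ratio {q : ℝ} (hq : 0 ≤ q) {N : ℕ}
    (h : ∀ k, N ≤ k → q * (n k : ℝ) ≤ n (k + 1)) {k : ℕ} (hk : N ≤ k) (j : ℕ) :
    q ^ j * (n k : ℝ) ≤ n (k + j) := by
  induction j with
  | zero => simp
  | succ j ih =>
    calc q ^ (j + 1) * (n k : ℝ) = q * (q ^ j * (n k : ℝ)) := by ring
      _ ≤ q * n (k + j) := by gcongr
      _ ≤ n (k + j + 1) := h _ (by omega)

theorem two_pow_mul_le (h2 : ∀ k, 2 * n k ≤ n (k + 1)) (k j : ℕ) :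
    (2 : ℝ) ^ j * (n k : ℝ) ≤ n (k + j) :=
  pow_mul_le_of_ratio (N := 0) (by norm_num) (fun k _ => by exact_mod_cast h2 k) (Nat.zero_le k) j

theorem strictMono_of_two_mul_le (hpos : ∀ k, 0 < n k) (h2 : ∀ k, 2 * n k ≤ n (k + 1)) :
    StrictMono n :=
  strictMono_nat_of_lt_succ fun k => by have := hpos k; have := h2 k; omega

theorem sum_exponents_le (h2 : ∀ k, 2 * n k ≤ n (k + 1)) (K : ℕ) :
    ∑ k ∈ Finset.range (K + 1), (n k : ℝ) ≤ 2 * n K := by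
  induction K with
  | zero => simp; linarith [Nat.cast_nonneg (α := ℝ) (n 0)]
  | succ K ih =>
    rw [Finset.sum_range_succ]
    have : (2 : ℝ) * n K ≤ n (K + 1) := by exact_mod_cast h2 K
    linarith

theorem inv_exponent_add_le (hpos : ∀ k, 0 < n k) (h2 : ∀ k, 2 * n k ≤ n (k + 1)) (K j : ℕ) :
    ((n (j + K) : ℝ))⁻¹ ≤ (n K : ℝ)⁻¹ * (1 / 2) ^ j := by
  have h := two_pow_mul_le h2 K j
  have hK : (0 : ℝ) < n K := by exact_mod_cast hpos K
  rw [add_comm K j] at h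
  calc ((n (j + K) : ℝ))⁻¹ ≤ ((2 : ℝ) ^ j * n K)⁻¹ := by gcongr
    _ = (n K : ℝ)⁻¹ * (1 / 2) ^ j := by rw [mul_inv, one_div, inv_pow, mul_comm]

theorem summable_inv_exponents (hpos : ∀ k, 0 < n k) (h2 : ∀ k, 2 * n k ≤ n (k + 1)) (K : ℕ) :
    Summable fun j => ((n (j + K) : ℝ))⁻¹ :=
  Summable.of_nonneg_of_le (fun _ => by positivity) (inv_exponent_add_le hpos h2 K)
    (summable_geometric_two.mul_left _)

theorem tsum_inv_exponents_le (hpos : ∀ k, 0 < n k) (h2 : ∀ k, 2 * n k ≤ n (k + 1)) (K : ℕ) :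
    ∑' j, ((n (j + K) : ℝ))⁻¹ ≤ 2 * (n K : ℝ)⁻¹ := by
  calc ∑' j, ((n (j + K) : ℝ))⁻¹ ≤ ∑' j, (n K : ℝ)⁻¹ * (1 / 2) ^ j :=
        (summable_inv_exponents hpos h2 K).tsum_le_tsum (inv_exponent_add_le hpos h2 K)
          (summable_geometric_two.mul_left _)
    _ = 2 * (n K : ℝ)⁻¹ := by rw [tsum_mul_left, tsum_geometric_two, mul_comm]

theorem exists_one_le_exponent_mul (hpos : ∀ k, 0 < n k) (h2 : ∀ k, 2 * n k ≤ n (k + 1)) {t : ℝ}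
    (ht : 0 < t) : ∃ k, 1 < (n k : ℝ) * t := by
  obtain ⟨m, hm⟩ := exists_nat_gt (1 / t)
  refine ⟨m, ?_⟩
  have h : (m : ℝ) ≤ n m := by exact_mod_cast (strictMono_of_two_mul_le hpos h2).le_apply
  rw [div_lt_iff₀ ht] at hm
  nlinarith

/-- If the terms `x k` are bounded by `A n_k t` and by `A / (n_k t)`, their sum is
at most `4 A`. -/
theorem tsum_le_of_le_min (hpos : ∀ k, 0 < n k) (h2 : ∀ k, 2 * n k ≤ n (k + 1)) {t A : ℝ}
    (ht : 0 < t) (hA : 0 ≤ A) {x : ℕ → ℝ} (hx : ∀ k, 0 ≤ x k) (h₁ : ∀ k, x k ≤ A * (n k * t))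
    (h₂ : ∀ k, x k ≤ A * (n k * t)⁻¹) : Summable x ∧ ∑' k, x k ≤ 4 * A := by
  have hs : ∀ K, Summable fun j => x (j + K) := fun K =>
    Summable.of_nonneg_of_le (fun _ => hx _) (fun j => h₂ (j + K)) <| by
      simp_rw [mul_inv, mul_comm _ t⁻¹]
      exact ((summable_inv_exponents hpos h2 K).mul_left _).mul_left _
  have hsum : Summable x := by simpa using hs 0
  refine ⟨hsum, ?_⟩
  have hex := exists_one_le_exponent_mul hpos h2 ht
  classical
  set K := Nat.find hex with hK
  have hK₁ : 1 < (n K : ℝ) * t := Nat.find_spec hex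
  have hK₂ : ∀ k < K, (n k : ℝ) * t ≤ 1 := fun k hk => not_lt.1 (Nat.find_min hex hk)
  have htail : ∑' j, x (j + K) ≤ 2 * A := by
    calc ∑' j, x (j + K) ≤ ∑' j, (A * t⁻¹) * ((n (j + K) : ℝ))⁻¹ :=
          (hs K).tsum_le_tsum (fun j => (h₂ _).trans_eq (by rw [mul_inv]; ring))
            ((summable_inv_exponents hpos h2 K).mul_left _)
      _ = (A * t⁻¹) * ∑' j, ((n (j + K) : ℝ))⁻¹ := tsum_mul_left
      _ ≤ (A * t⁻¹) * (2 * (n K : ℝ)⁻¹) := by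
          gcongr; exact tsum_inv_exponents_le hpos h2 K
      _ = 2 * A * ((n K : ℝ) * t)⁻¹ := by rw [mul_inv]; ring
      _ ≤ 2 * A * 1 := by gcongr; exact inv_le_one_of_one_le₀ hK₁.le
      _ = 2 * A := mul_one _
  have hhead : ∑ k ∈ Finset.range K, x k ≤ 2 * A := by
    rcases Nat.eq_zero_or_eq_succ_pred K with h0 | h0
    · rw [h0]; simp [hA]
    · set L := K.pred
      calc ∑ k ∈ Finset.range K, x k ≤ ∑ k ∈ Finset.range K, A * (n k * t) :=
            Finset.sum_le_sum fun k _ => h₁ k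
        _ = A * t * ∑ k ∈ Finset.range (L + 1), (n k : ℝ) := by
            rw [h0, Finset.mul_sum]; exact Finset.sum_congr rfl fun _ _ => by ring
        _ ≤ A * t * (2 * n L) := by gcongr; exact sum_exponents_le h2 L
        _ = 2 * A * (n L * t) := by ring
        _ ≤ 2 * A * 1 := by gcongr; exact hK₂ L (by omega)
        _ = 2 * A := mul_one _
  rw [← hsum.sum_add_tsum_nat_add K]
  linarith

end Exponents

/-! ### Differences of powers -/

theorem norm_pow_sub_pow_le {z ζ : ℂ} (hz : ‖z‖ ≤ 1) (hζ : ‖ζ‖ ≤ 1) (m : ℕ) :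
    ‖z ^ m - ζ ^ m‖ ≤ m * ‖z - ζ‖ := by
  induction m with
  | zero => simp
  | succ m ih =>
    have h : z ^ (m + 1) - ζ ^ (m + 1) = z * (z ^ m - ζ ^ m) + (z - ζ) * ζ ^ m := by ring
    rw [h]
    calc _ ≤ ‖z‖ * ‖z ^ m - ζ ^ m‖ + ‖z - ζ‖ * ‖ζ‖ ^ m := by
          rw [← norm_pow, ← norm_mul, ← norm_mul]; exact norm_add_le _ _
      _ ≤ 1 * (m * ‖z - ζ‖) + ‖z - ζ‖ * 1 := by
          gcongr; exact pow_le_one₀ (norm_nonneg _) hζ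
      _ = _ := by push_cast; ring

/-- Bernoulli gives `1 + m (1 - r) ≤ (2 - r) ^ m`, and `r (2 - r) ≤ 1`. -/
theorem pow_le_inv_mul {r : ℝ} (h0 : 0 ≤ r) (h1 : r < 1) {m : ℕ} (hm : 0 < m) :
    r ^ m ≤ (m * (1 - r))⁻¹ := by
  have h := one_add_mul_le_pow (a := 1 - r) (by linarith) m
  have hm' : (0 : ℝ) < m := by exact_mod_cast hm
  have hp : 0 < (m : ℝ) * (1 - r) := mul_pos hm' (by linarith)
  rw [← one_div, le_div_iff₀ hp]
  have h3 : r ^ m * (1 + (1 - r)) ^ m ≤ 1 := by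
    rw [← mul_pow]
    exact pow_le_one₀ (by nlinarith) (by nlinarith)
  have := pow_nonneg h0 m
  nlinarith

theorem norm_pow_sub_pow_le_inv {z ζ : ℂ} (hzζ : ‖z‖ ≤ ‖ζ‖) (hζ : ‖ζ‖ < 1) {m : ℕ} (hm : 0 < m) :
    ‖z ^ m - ζ ^ m‖ ≤ 2 * (m * (1 - ‖ζ‖))⁻¹ := by
  have h := pow_le_inv_mul (norm_nonneg ζ) hζ hm
  have h' : ‖z‖ ^ m ≤ ‖ζ‖ ^ m := by gcongr
  calc _ ≤ ‖z ^ m‖ + ‖ζ ^ m‖ := norm_sub_le _ _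
    _ = ‖z‖ ^ m + ‖ζ‖ ^ m := by rw [norm_pow, norm_pow]
    _ ≤ _ := by linarith

theorem norm_pow_sub_pow_le_two {z ζ : ℂ} (hz : ‖z‖ ≤ 1) (hζ : ‖ζ‖ ≤ 1) (m : ℕ) :
    ‖z ^ m - ζ ^ m‖ ≤ 2 := by
  have h1 := pow_le_one₀ (norm_nonneg z) hz (n := m)
  have h2 := pow_le_one₀ (norm_nonneg ζ) hζ (n := m)
  calc _ ≤ ‖z ^ m‖ + ‖ζ ^ m‖ := norm_sub_le _ _
    _ = ‖z‖ ^ m + ‖ζ‖ ^ m := by rw [norm_pow, norm_pow]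
    _ ≤ _ := by linarith

/-! ### The hyperbolic distance -/

theorem mem_disc {z : ℂ} : z ∈ disc ↔ ‖z‖ < 1 := by simp [disc]

theorem isOpen_disc : IsOpen disc := Metric.isOpen_ball

theorem norm_one_sub_conj_mul_sq (z ζ : ℂ) :
    ‖1 - (starRingEnd ℂ) z * ζ‖ ^ 2 = ‖z - ζ‖ ^ 2 + (1 - ‖z‖ ^ 2) * (1 - ‖ζ‖ ^ 2) := by
  simp only [← Complex.normSq_eq_norm_sq, Complex.normSq_apply]
  simp
  ring

theorem norm_one_sub_conj_mul_pos {z ζ : ℂ} (hz : ‖z‖ < 1) (hζ : ‖ζ‖ < 1) :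
    0 < ‖1 - (starRingEnd ℂ) z * ζ‖ ^ 2 := by
  rw [norm_one_sub_conj_mul_sq]
  have h1 : 0 < 1 - ‖z‖ ^ 2 := by nlinarith [norm_nonneg z]
  have h2 : 0 < 1 - ‖ζ‖ ^ 2 := by nlinarith [norm_nonneg ζ]
  positivity

theorem one_sub_norm_moebius_sq {z ζ : ℂ} (hz : ‖z‖ < 1) (hζ : ‖ζ‖ < 1) :
    1 - ‖moebius z ζ‖ ^ 2 =
      (1 - ‖z‖ ^ 2) * (1 - ‖ζ‖ ^ 2) / ‖1 - (starRingEnd ℂ) z * ζ‖ ^ 2 := by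
  have h := norm_one_sub_conj_mul_pos hz hζ
  rw [moebius, norm_div, div_pow, eq_div_iff h.ne', sub_mul, div_mul_cancel₀ _ h.ne',
    norm_one_sub_conj_mul_sq]
  ring

theorem norm_moebius_lt_one {z ζ : ℂ} (hz : ‖z‖ < 1) (hζ : ‖ζ‖ < 1) : ‖moebius z ζ‖ < 1 := by
  have h : 0 < 1 - ‖moebius z ζ‖ ^ 2 := by
    rw [one_sub_norm_moebius_sq hz hζ]
    have h1 : 0 < 1 - ‖z‖ ^ 2 := by nlinarith [norm_nonneg z]
    have h2 : 0 < 1 - ‖ζ‖ ^ 2 := by nlinarith [norm_nonneg ζ]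
    have := norm_one_sub_conj_mul_pos hz hζ
    positivity
  nlinarith [norm_nonneg (moebius z ζ)]

theorem hypDist_nonneg {z ζ : ℂ} (hz : ‖z‖ < 1) (hζ : ‖ζ‖ < 1) : 0 ≤ hypDist z ζ := by
  have h := norm_moebius_lt_one hz hζ
  have h0 := norm_nonneg (moebius z ζ)
  refine mul_nonneg (by norm_num) (Real.log_nonneg ?_)
  rw [le_div_iff₀ (by linarith)]
  linarith

theorem hypDist_comm (z ζ : ℂ) : hypDist z ζ = hypDist ζ z := by
  have : ‖moebius z ζ‖ = ‖moebius ζ z‖ := by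
    rw [moebius, moebius, norm_div, norm_div, norm_sub_rev z ζ]
    congr 1
    rw [← Complex.norm_conj (1 - (starRingEnd ℂ) z * ζ)]
    simp [mul_comm]
  rw [hypDist, hypDist, this]

/-- With `s = |z - ζ|` and `t = 1 - |ζ| ≤ s` one has `1 - |z| ≤ 2 s`, and the identity for `1 -
|φ|²` bounds it by `(4 s)(2 t) / s² = 8 t / s`. -/
theorem log_le_hypDist {z ζ : ℂ} (hzζ : ‖z‖ ≤ ‖ζ‖) (hζ : ‖ζ‖ < 1) (hs : 1 - ‖ζ‖ ≤ ‖z - ζ‖) :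
    Real.log (‖z - ζ‖ / (1 - ‖ζ‖)) ≤ 2 * hypDist z ζ + Real.log 8 := by
  have hz : ‖z‖ < 1 := hzζ.trans_lt hζ
  have ht : 0 < 1 - ‖ζ‖ := by linarith
  have hφ := norm_moebius_lt_one hz hζ
  have hφ0 := norm_nonneg (moebius z ζ)
  have hs0 : 0 < ‖z - ζ‖ := ht.trans_le hs
  have hd : 1 - ‖z‖ ≤ 2 * ‖z - ζ‖ := by
    have := norm_sub_norm_le ζ z
    rw [norm_sub_rev] at this
    linarith
  have hkey : (1 - ‖moebius z ζ‖) * ‖z - ζ‖ ≤ 8 * (1 - ‖ζ‖) := by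
    have h1 : 1 - ‖moebius z ζ‖ ≤ 1 - ‖moebius z ζ‖ ^ 2 := by nlinarith
    have hD := norm_one_sub_conj_mul_sq z ζ
    have hDpos := norm_one_sub_conj_mul_pos hz hζ
    have hz2 : 1 - ‖z‖ ^ 2 ≤ 4 * ‖z - ζ‖ := by nlinarith [norm_nonneg z]
    have hz0 : 0 ≤ 1 - ‖z‖ ^ 2 := by nlinarith [norm_nonneg z]
    have hζ2 : 1 - ‖ζ‖ ^ 2 ≤ 2 * (1 - ‖ζ‖) := by nlinarith [norm_nonneg ζ]
    have hζ0 : 0 ≤ 1 - ‖ζ‖ ^ 2 := by nlinarith [norm_nonneg ζ]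
    have hDs : ‖z - ζ‖ ^ 2 ≤ ‖1 - (starRingEnd ℂ) z * ζ‖ ^ 2 := by
      rw [hD]; nlinarith [mul_nonneg hz0 hζ0]
    have h2 : 1 - ‖moebius z ζ‖ ^ 2 ≤ 4 * ‖z - ζ‖ * (2 * (1 - ‖ζ‖)) / ‖z - ζ‖ ^ 2 := by
      rw [one_sub_norm_moebius_sq hz hζ]
      gcongr
    calc (1 - ‖moebius z ζ‖) * ‖z - ζ‖
        ≤ 4 * ‖z - ζ‖ * (2 * (1 - ‖ζ‖)) / ‖z - ζ‖ ^ 2 * ‖z - ζ‖ := by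
          gcongr; exact h1.trans h2
      _ = 8 * (1 - ‖ζ‖) := by field_simp; ring
  have h : ‖z - ζ‖ / (1 - ‖ζ‖) ≤ 8 * ((1 + ‖moebius z ζ‖) / (1 - ‖moebius z ζ‖)) := by
    rw [← mul_div_assoc, div_le_div_iff₀ ht (by linarith)]
    nlinarith
  have hq : 0 < (1 + ‖moebius z ζ‖) / (1 - ‖moebius z ζ‖) := div_pos (by linarith) (by linarith)
  calc _ ≤ Real.log (8 * ((1 + ‖moebius z ζ‖) / (1 - ‖moebius z ζ‖))) :=
        Real.log_le_log (div_pos hs0 ht) h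
    _ = _ := by rw [Real.log_mul (by norm_num) hq.ne', hypDist]; ring

/-! ### Oscillation of lacunary series -/

theorem tsum_norm_pow_sub_pow_le {n : ℕ → ℕ} (hpos : ∀ k, 0 < n k)
    (h2 : ∀ k, 2 * n k ≤ n (k + 1)) {q : ℝ} (hq : 1 < q) {N : ℕ}
    (hN : ∀ k, N ≤ k → q * (n k : ℝ) ≤ n (k + 1)) {z ζ : ℂ} (hzζ : ‖z‖ ≤ ‖ζ‖) (hζ : ‖ζ‖ < 1) :
    Summable (fun k => ‖z ^ n k - ζ ^ n k‖) ∧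
      ∑' k, ‖z ^ n k - ζ ^ n k‖ ≤
        2 * N + 8 + 2 * Real.log 8 / Real.log q + 4 / Real.log q * hypDist z ζ := by
  have hz : ‖z‖ < 1 := hzζ.trans_lt hζ
  have hmono := strictMono_of_two_mul_le hpos h2
  have hlogq : 0 < Real.log q := Real.log_pos hq
  have ht : 0 < 1 - ‖ζ‖ := by linarith
  have hβ := hypDist_nonneg hz hζ
  have hR : 0 ≤ 2 * Real.log 8 / Real.log q + 4 / Real.log q * hypDist z ζ := by
    have : 0 < Real.log 8 := Real.log_pos (by norm_num)
    positivity
  -- For `s < t` there is no middle range of exponents, and the single cutoff at `1 / t` suffices.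
  by_cases hst : ‖z - ζ‖ < 1 - ‖ζ‖
  · obtain ⟨h₁, h₂⟩ := tsum_le_of_le_min hpos h2 ht (A := 2) (by norm_num)
      (x := fun k => ‖z ^ n k - ζ ^ n k‖) (fun _ => norm_nonneg _)
      (fun k => (norm_pow_sub_pow_le hz.le hζ.le _).trans (by
        have : (n k : ℝ) * ‖z - ζ‖ ≤ n k * (1 - ‖ζ‖) := by gcongr
        have := norm_nonneg (z - ζ)
        have : 0 ≤ (n k : ℝ) * (1 - ‖ζ‖) := by positivity
        linarith))
      (fun k => norm_pow_sub_pow_le_inv hzζ hζ (hpos k))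
    refine ⟨h₁, ?_⟩
    have : (0 : ℝ) ≤ N := Nat.cast_nonneg N
    linarith
  push Not at hst
  set s := ‖z - ζ‖ with hs_def
  set t := 1 - ‖ζ‖ with ht_def
  have hs0 : 0 < s := ht.trans_le hst
  have hlog := log_le_hypDist hzζ hζ hst
  classical
  have hexs := exists_one_le_exponent_mul hpos h2 hs0
  have hKs : 1 < (n (Nat.find hexs) : ℝ) * s := Nat.find_spec hexs
  have hKs' : ∀ k < Nat.find hexs, (n k : ℝ) * s ≤ 1 :=
    fun k hk => not_lt.1 (Nat.find_min hexs hk)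
  set Ks := Nat.find hexs
  have hext := exists_one_le_exponent_mul hpos h2 ht
  have hKt : 1 < (n (Nat.find hext) : ℝ) * t := Nat.find_spec hext
  have hKt' : ∀ k < Nat.find hext, (n k : ℝ) * t ≤ 1 :=
    fun k hk => not_lt.1 (Nat.find_min hext hk)
  set Kt := Nat.find hext
  have hs : ∀ K, Summable fun j => ‖z ^ n (j + K) - ζ ^ n (j + K)‖ := fun K =>
    Summable.of_nonneg_of_le (fun _ => norm_nonneg _)
      (fun j => norm_pow_sub_pow_le_inv hzζ hζ (hpos (j + K))) <| by
      simp_rw [mul_inv, mul_comm _ (1 - ‖ζ‖)⁻¹]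
      exact ((summable_inv_exponents hpos h2 K).mul_left _).mul_left _
  have hsum : Summable fun k => ‖z ^ n k - ζ ^ n k‖ := by simpa using hs 0
  refine ⟨hsum, ?_⟩
  have htail : ∑' j, ‖z ^ n (j + Kt) - ζ ^ n (j + Kt)‖ ≤ 4 := by
    calc _ ≤ ∑' j, (2 * t⁻¹) * ((n (j + Kt) : ℝ))⁻¹ :=
          (hs Kt).tsum_le_tsum
            (fun j => (norm_pow_sub_pow_le_inv hzζ hζ (hpos _)).trans_eq (by rw [mul_inv]; ring))
            ((summable_inv_exponents hpos h2 Kt).mul_left _)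
      _ = (2 * t⁻¹) * ∑' j, ((n (j + Kt) : ℝ))⁻¹ := tsum_mul_left
      _ ≤ (2 * t⁻¹) * (2 * (n Kt : ℝ)⁻¹) := by
          gcongr; exact tsum_inv_exponents_le hpos h2 Kt
      _ = 4 * ((n Kt : ℝ) * t)⁻¹ := by rw [mul_inv]; ring
      _ ≤ 4 * 1 := by gcongr; exact inv_le_one_of_one_le₀ hKt.le
      _ = 4 := mul_one _
  have hsmall : ∑ k ∈ Finset.range Ks, (n k : ℝ) * s ≤ 2 := by
    rcases Nat.eq_zero_or_eq_succ_pred Ks with h0 | h0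
    · rw [h0]; simp
    · set L := Ks.pred
      calc ∑ k ∈ Finset.range Ks, (n k : ℝ) * s
          = s * ∑ k ∈ Finset.range (L + 1), (n k : ℝ) := by
            rw [h0, Finset.mul_sum]; exact Finset.sum_congr rfl fun _ _ => by ring
        _ ≤ s * (2 * n L) := by gcongr; exact sum_exponents_le h2 L
        _ = 2 * (n L * s) := by ring
        _ ≤ 2 * 1 := by gcongr; exact hKs' L (by omega)
        _ = 2 := mul_one _
  have hmid : ((Finset.Ico (max Ks N) Kt).card : ℝ) ≤
      1 + Real.log 8 / Real.log q + 2 / Real.log q * hypDist z ζ := by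
    rw [Nat.card_Ico]
    rcases le_or_gt Kt (max Ks N) with h | h
    · rw [Nat.sub_eq_zero_of_le h]
      have : 2 * Real.log 8 / Real.log q + 4 / Real.log q * hypDist z ζ =
        2 * (Real.log 8 / Real.log q + 2 / Real.log q * hypDist z ζ) := by ring
      push_cast
      linarith
    -- The middle block runs from `a = max Ks N` to `a + j = Kt - 1`. As `n_a > 1 / s`, `n_{a+j} ≤ 1
    -- / t` and each ratio is at least `q`, it follows that `q ^ j ≤ s / t`.
    · obtain ⟨j, hj⟩ : ∃ j, Kt = max Ks N + j + 1 := ⟨Kt - max Ks N - 1, by omega⟩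
      have e : Kt - max Ks N = j + 1 := by omega
      rw [e]
      set a := max Ks N
      have ha : 1 < (n a : ℝ) * s := hKs.trans_le (by
        have : (n Ks : ℝ) ≤ n a := by exact_mod_cast hmono.monotone (le_max_left _ _)
        gcongr)
      have hb : (n (a + j) : ℝ) * t ≤ 1 := hKt' _ (by omega)
      have hab := pow_mul_le_of_ratio (by linarith) hN (le_max_right Ks N) j
      have hna : (0 : ℝ) < n a := by exact_mod_cast hpos a
      have hqj : q ^ j ≤ s / t := by
        rw [le_div_iff₀ ht]
        have h1 : q ^ j * n a * t ≤ 1 := (mul_le_mul_of_nonneg_right hab ht.le).trans hb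
        have h2 : n a * (q ^ j * t) ≤ n a * s := by linarith
        exact le_of_mul_le_mul_left h2 hna
      have hlogj : (j : ℝ) * Real.log q ≤ 2 * hypDist z ζ + Real.log 8 := by
        rw [← Real.log_pow]
        exact (Real.log_le_log (by positivity) hqj).trans hlog
      have : (j : ℝ) ≤ (2 * hypDist z ζ + Real.log 8) / Real.log q := by
        rwa [le_div_iff₀ hlogq]
      push_cast
      calc (j : ℝ) + 1 ≤ (2 * hypDist z ζ + Real.log 8) / Real.log q + 1 := by linarith
        _ = _ := by ring
  have hhead : ∑ k ∈ Finset.range Kt, ‖z ^ n k - ζ ^ n k‖ ≤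
      2 + 2 * N + 2 * (Finset.Ico (max Ks N) Kt).card := by
    have hsub : Finset.range Kt ⊆
        (Finset.range Ks ∪ Finset.range N) ∪ Finset.Ico (max Ks N) Kt := by
      intro k hk
      simp only [Finset.mem_union, Finset.mem_range, Finset.mem_Ico] at hk ⊢
      omega
    have hu : ∀ A B : Finset ℕ, ∑ k ∈ A ∪ B, ‖z ^ n k - ζ ^ n k‖ ≤
        ∑ k ∈ A, ‖z ^ n k - ζ ^ n k‖ + ∑ k ∈ B, ‖z ^ n k - ζ ^ n k‖ := fun A B => by
      rw [← Finset.sum_union_inter]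
      exact le_add_of_nonneg_right (Finset.sum_nonneg fun _ _ => norm_nonneg _)
    have htwo : ∀ A : Finset ℕ, ∑ k ∈ A, ‖z ^ n k - ζ ^ n k‖ ≤ 2 * A.card := fun A => by
      refine (Finset.sum_le_card_nsmul _ _ 2
        fun k _ => norm_pow_sub_pow_le_two hz.le hζ.le _).trans_eq ?_
      rw [nsmul_eq_mul, mul_comm]
    have h1 := Finset.sum_le_sum_of_subset_of_nonneg hsub
      (f := fun k => ‖z ^ n k - ζ ^ n k‖) fun _ _ _ => norm_nonneg _
    have h3 := hu (Finset.range Ks ∪ Finset.range N) (Finset.Ico (max Ks N) Kt)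
    have h4 := hu (Finset.range Ks) (Finset.range N)
    have h5 := htwo (Finset.range N)
    have h6 := htwo (Finset.Ico (max Ks N) Kt)
    have h7 : ∑ k ∈ Finset.range Ks, ‖z ^ n k - ζ ^ n k‖ ≤ 2 :=
      (Finset.sum_le_sum fun k _ => norm_pow_sub_pow_le hz.le hζ.le (n k)).trans hsmall
    rw [Finset.card_range] at h5
    linarith
  rw [← hsum.sum_add_tsum_nat_add Kt]
  calc _ ≤ 2 + 2 * N + 2 * ((Finset.Ico (max Ks N) Kt).card : ℝ) + 4 := add_le_add hhead htail
    _ ≤ 2 + 2 * N + 2 * (1 + Real.log 8 / Real.log q + 2 / Real.log q * hypDist z ζ) + 4 := by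
        gcongr
    _ = _ := by ring

/-! ### The lacunary series with coefficients one -/

/-- The power series `∑ z ^ n_k`. -/
noncomputable def lacunarySum (n : ℕ → ℕ) (z : ℂ) : ℂ := ∑' k, z ^ n k

/-- With `x = m (1 - r)`, `r ^ (m - 1) ≤ e · e^{-x}` and `x² e^{-x} ≤ 2`; the constant is `2 e ≤ 6`.
-/
theorem mul_pow_pred_le {r : ℝ} (h0 : 0 ≤ r) (h1 : r < 1) {m : ℕ} (hm : 0 < m) :
    (1 - r) * (m * r ^ (m - 1)) ≤ 6 * (m * (1 - r))⁻¹ := by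
  have hm' : (0 : ℝ) < m := by exact_mod_cast hm
  set x : ℝ := m * (1 - r) with hx
  have hx0 : 0 < x := mul_pos hm' (by linarith)
  have hr : r ^ (m - 1) ≤ Real.exp 1 * Real.exp (-x) := by
    have h : r ≤ Real.exp (-(1 - r)) := by
      have := Real.add_one_le_exp (-(1 - r)); linarith
    calc r ^ (m - 1) ≤ Real.exp (-(1 - r)) ^ (m - 1) := by gcongr
      _ = Real.exp ((1 - r) + -x) := by
          rw [← Real.exp_nat_mul, Nat.cast_sub hm]; congr 1; rw [hx]; push_cast; ring
      _ ≤ Real.exp (1 + -x) := by gcongr; linarith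
      _ = _ := Real.exp_add _ _
  have hexp : x ^ 2 / 2 * Real.exp (-x) ≤ 1 := by
    rw [Real.exp_neg, ← div_eq_mul_inv, div_le_one (Real.exp_pos _)]
    linarith [Real.quadratic_le_exp_of_nonneg hx0.le]
  have he := Real.exp_one_lt_d9
  rw [← div_eq_mul_inv, le_div_iff₀ hx0]
  calc (1 - r) * (m * r ^ (m - 1)) * x = x ^ 2 * r ^ (m - 1) := by rw [hx]; ring
    _ ≤ x ^ 2 * (Real.exp 1 * Real.exp (-x)) := by gcongr
    _ = 2 * Real.exp 1 * (x ^ 2 / 2 * Real.exp (-x)) := by ring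
    _ ≤ 2 * Real.exp 1 * 1 := by gcongr
    _ ≤ 6 := by linarith

theorem exp_neg_one_le_pow_pred {m : ℕ} (hm : 0 < m) :
    Real.exp (-1) ≤ (1 - 1 / (m : ℝ)) ^ (m - 1) := by
  obtain ⟨l, rfl⟩ : ∃ l, m = l + 1 := ⟨m - 1, by omega⟩
  rcases Nat.eq_zero_or_pos l with rfl | hl
  · simp
  have hl' : (0 : ℝ) < l := by exact_mod_cast hl
  have e : (1 - 1 / ((l + 1 : ℕ) : ℝ)) = (1 / (l : ℝ) + 1)⁻¹ := by
    push_cast; field_simp; ring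
  rw [Nat.add_sub_cancel, e]
  calc Real.exp (-1) = (Real.exp (1 / l))⁻¹ ^ l := by
        rw [← Real.exp_neg, ← Real.exp_nat_mul]; congr 1; field_simp
    _ ≤ _ := by gcongr; exact Real.add_one_le_exp _

section Series

variable {n : ℕ → ℕ}

theorem summable_pow_exponents (hpos : ∀ k, 0 < n k) (h2 : ∀ k, 2 * n k ≤ n (k + 1)) {r : ℝ}
    (h0 : 0 ≤ r) (h1 : r < 1) : Summable fun k => r ^ n k :=
  Summable.of_nonneg_of_le (fun _ => pow_nonneg h0 _)
    (fun _ => pow_le_pow_of_le_one h0 h1.le (strictMono_of_two_mul_le hpos h2).le_apply)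
    (summable_geometric_of_lt_one h0 h1)

theorem hasSum_lacunarySum (hpos : ∀ k, 0 < n k) (h2 : ∀ k, 2 * n k ≤ n (k + 1)) {z : ℂ}
    (hz : z ∈ disc) : HasSum (fun k => z ^ n k) (lacunarySum n z) := by
  refine (Summable.of_norm ?_).hasSum
  simpa only [norm_pow] using summable_pow_exponents hpos h2 (norm_nonneg z) (mem_disc.1 hz)

theorem differentiableAt_lacunarySum (hpos : ∀ k, 0 < n k) (h2 : ∀ k, 2 * n k ≤ n (k + 1)) {z : ℂ}
    (hz : z ∈ disc) : DifferentiableAt ℂ (lacunarySum n) z ∧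
      HasSum (fun k => (n k : ℂ) * z ^ (n k - 1)) (deriv (lacunarySum n) z) := by
  rw [mem_disc] at hz
  set r := (1 + ‖z‖) / 2 with hr
  have hr0 : 0 ≤ r := by have := norm_nonneg z; positivity
  have hr1 : r < 1 := by linarith
  have hzr : z ∈ Metric.ball (0 : ℂ) r := by simp; linarith
  have hu := summable_pow_exponents hpos h2 hr0 hr1
  have hd : ∀ k, DifferentiableOn ℂ (fun w : ℂ => w ^ n k) (Metric.ball 0 r) := fun k =>
    (differentiable_pow (n k)).differentiableOn
  have hb : ∀ (k : ℕ) (w : ℂ), w ∈ Metric.ball (0 : ℂ) r → ‖w ^ n k‖ ≤ r ^ n k := by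
    intro k w hw
    rw [norm_pow]
    have : ‖w‖ < r := by simpa using hw
    gcongr
  refine ⟨(Complex.differentiableOn_tsum_of_summable_norm hu hd Metric.isOpen_ball hb z
    hzr).differentiableAt (Metric.isOpen_ball.mem_nhds hzr), ?_⟩
  have h := Complex.hasSum_deriv_of_summable_norm hu hd Metric.isOpen_ball hb hzr
  simp only [deriv_pow_field] at h
  exact h

theorem summable_deriv_lacunarySum (hpos : ∀ k, 0 < n k) (h2 : ∀ k, 2 * n k ≤ n (k + 1)) {r : ℝ}
    (h0 : 0 ≤ r) (h1 : r < 1) :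
    Summable (fun k => (1 - r) * (n k * r ^ (n k - 1))) ∧
      ∑' k, (1 - r) * (n k * r ^ (n k - 1)) ≤ 24 := by
  have ht : 0 < 1 - r := by linarith
  have h := tsum_le_of_le_min hpos h2 ht (A := 6) (by norm_num)
    (x := fun k => (1 - r) * (n k * r ^ (n k - 1))) (fun k => by positivity)
    (fun k => by
      have : r ^ (n k - 1) ≤ 1 := pow_le_one₀ h0 h1.le
      have h3 : (0 : ℝ) ≤ n k * (1 - r) := by positivity
      nlinarith) (fun k => mul_pow_pred_le h0 h1 (hpos k))
  exact ⟨h.1, h.2.trans (by norm_num)⟩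

theorem one_sub_mul_norm_deriv_lacunarySum_le (hpos : ∀ k, 0 < n k)
    (h2 : ∀ k, 2 * n k ≤ n (k + 1)) {z : ℂ} (hz : z ∈ disc) :
    (1 - ‖z‖) * ‖deriv (lacunarySum n) z‖ ≤ 24 := by
  have hz' := mem_disc.1 hz
  obtain ⟨hs, hle⟩ := summable_deriv_lacunarySum hpos h2 (norm_nonneg z) hz'
  refine le_trans ?_ hle
  have h := (differentiableAt_lacunarySum hpos h2 hz).2.mul_left ((1 - ‖z‖ : ℝ) : ℂ)
  have e : (1 - ‖z‖) * ‖deriv (lacunarySum n) z‖ =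
      ‖((1 - ‖z‖ : ℝ) : ℂ) * deriv (lacunarySum n) z‖ := by
    rw [norm_mul, Complex.norm_real, Real.norm_of_nonneg (by linarith)]
  rw [e]
  refine h.norm_le_of_bounded hs.hasSum fun k => le_of_eq ?_
  rw [norm_mul, Complex.norm_real, Real.norm_of_nonneg (by linarith), norm_mul, norm_pow,
    Complex.norm_natCast]

theorem lacunarySum_mem_blochSpace (hpos : ∀ k, 0 < n k) (h2 : ∀ k, 2 * n k ≤ n (k + 1)) :
    lacunarySum n ∈ blochSpace := by
  refine ⟨fun z hz => (differentiableAt_lacunarySum hpos h2 hz).1.differentiableWithinAt, ?_⟩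
  refine lt_of_le_of_lt (iSup₂_le fun z hz => ENNReal.ofReal_le_ofReal ?_)
    -- `48 = 2 · 24`, from `1 - |z|² ≤ 2 (1 - |z|)`.
    (ENNReal.ofReal_lt_top (r := 48))
  have h := one_sub_mul_norm_deriv_lacunarySum_le hpos h2 hz
  have hz' := mem_disc.1 hz
  have h0 := norm_nonneg z
  have hd := norm_nonneg (deriv (lacunarySum n) z)
  have : 0 ≤ (1 - ‖z‖) * ‖deriv (lacunarySum n) z‖ := mul_nonneg (by linarith) hd
  nlinarith

/-- The term of index `k + 1` has size at least `0.36`, just below `1 / e`. The earlier terms total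
at most `2 / 140` and the later ones at most `12 / 140`, which leaves `0.26`. -/
theorem le_norm_deriv_lacunarySum (hpos : ∀ k, 0 < n k) (h2 : ∀ k, 2 * n k ≤ n (k + 1)) {k : ℕ}
    (hk : 140 * (n k : ℝ) ≤ n (k + 1)) (hk' : 140 * (n (k + 1) : ℝ) ≤ n (k + 2)) {z : ℂ}
    (hz : ‖z‖ = 1 - 1 / n (k + 1)) : 1 / 4 ≤ (1 - ‖z‖) * ‖deriv (lacunarySum n) z‖ := by
  have hn : (0 : ℝ) < n (k + 1) := by exact_mod_cast hpos (k + 1)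
  have hn2 : (0 : ℝ) < n (k + 2) := by exact_mod_cast hpos (k + 2)
  have ht : 1 - ‖z‖ = 1 / n (k + 1) := by rw [hz]; ring
  have ht0 : 0 < 1 - ‖z‖ := by rw [ht]; positivity
  have hz1 : ‖z‖ < 1 := by linarith
  have hzd : z ∈ disc := mem_disc.2 hz1
  set c : ℕ → ℂ := fun j => ((1 - ‖z‖ : ℝ) : ℂ) * ((n j : ℂ) * z ^ (n j - 1)) with hc
  have hcn : ∀ j, ‖c j‖ = (1 - ‖z‖) * (n j * ‖z‖ ^ (n j - 1)) := fun j => by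
    simp only [hc]
    rw [norm_mul, Complex.norm_real, Real.norm_of_nonneg ht0.le, norm_mul, norm_pow,
      Complex.norm_natCast]
  have h := (differentiableAt_lacunarySum hpos h2 hzd).2.mul_left ((1 - ‖z‖ : ℝ) : ℂ)
  have e : (1 - ‖z‖) * ‖deriv (lacunarySum n) z‖ = ‖∑' j, c j‖ := by
    rw [h.tsum_eq, norm_mul, Complex.norm_real, Real.norm_of_nonneg ht0.le]
  have hsn : Summable fun j => ‖c j‖ := by
    simp_rw [hcn]; exact (summable_deriv_lacunarySum hpos h2 (norm_nonneg z) hz1).1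
  have hsplit := h.summable.sum_add_tsum_nat_add (k + 2)
  rw [Finset.sum_range_succ] at hsplit
  have hhead : ‖∑ j ∈ Finset.range (k + 1), c j‖ ≤ 2 / 140 := by
    calc _ ≤ ∑ j ∈ Finset.range (k + 1), ‖c j‖ := norm_sum_le _ _
      _ ≤ ∑ j ∈ Finset.range (k + 1), (1 - ‖z‖) * n j := by
          refine Finset.sum_le_sum fun j _ => ?_
          rw [hcn]
          have : ‖z‖ ^ (n j - 1) ≤ 1 := pow_le_one₀ (norm_nonneg _) hz1.le
          gcongr
          exact mul_le_of_le_one_right (Nat.cast_nonneg _) this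
      _ = (1 - ‖z‖) * ∑ j ∈ Finset.range (k + 1), (n j : ℝ) := by rw [Finset.mul_sum]
      _ ≤ (1 - ‖z‖) * (2 * n k) := by gcongr; exact sum_exponents_le h2 k
      _ ≤ 2 / 140 := by rw [ht, one_div_mul_eq_div, div_le_div_iff₀ hn (by norm_num)]; linarith
  have hterm : 36 / 100 ≤ ‖c (k + 1)‖ := by
    rw [hcn, ht, ← mul_assoc, one_div_mul_cancel hn.ne', one_mul, hz]
    refine le_trans ?_ (exp_neg_one_le_pow_pred (hpos (k + 1)))
    rw [Real.exp_neg, le_inv_comm₀ (by norm_num) (Real.exp_pos _)]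
    exact Real.exp_one_lt_d9.le.trans (by norm_num)
  have htail : ‖∑' j, c (j + (k + 2))‖ ≤ 12 / 140 := by
    have hs := (summable_nat_add_iff (k + 2)).2 hsn
    calc _ ≤ ∑' j, ‖c (j + (k + 2))‖ := norm_tsum_le_tsum_norm hs
      _ ≤ ∑' j, (6 * (1 - ‖z‖)⁻¹) * ((n (j + (k + 2)) : ℝ))⁻¹ := by
          refine hs.tsum_le_tsum (fun j => ?_)
            ((summable_inv_exponents hpos h2 (k + 2)).mul_left _)
          rw [hcn]
          refine (mul_pow_pred_le (norm_nonneg z) hz1 (hpos _)).trans_eq ?_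
          rw [mul_inv]; ring
      _ = (6 * (1 - ‖z‖)⁻¹) * ∑' j, ((n (j + (k + 2)) : ℝ))⁻¹ := tsum_mul_left
      _ ≤ (6 * (1 - ‖z‖)⁻¹) * (2 * (n (k + 2) : ℝ)⁻¹) := by
          gcongr; exact tsum_inv_exponents_le hpos h2 (k + 2)
      _ = 12 * n (k + 1) / n (k + 2) := by rw [ht]; field_simp; ring
      _ ≤ 12 / 140 := by rw [div_le_div_iff₀ hn2 (by norm_num)]; linarith
  rw [e]
  have h3 : c (k + 1) = ∑' j, c j - ∑ j ∈ Finset.range (k + 1), c j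
      - ∑' j, c (j + (k + 2)) := by
    rw [← hsplit]; simp only [hc]; ring
  have h4 : ‖c (k + 1)‖ ≤ ‖∑' j, c j‖ + ‖∑ j ∈ Finset.range (k + 1), c j‖
      + ‖∑' j, c (j + (k + 2))‖ := by
    rw [h3]
    exact (norm_sub_le _ _).trans (add_le_add_left (norm_sub_le _ _) _)
  linarith

theorem norm_lacunarySum_sub_le (hpos : ∀ k, 0 < n k) (h2 : ∀ k, 2 * n k ≤ n (k + 1))
    {q : ℝ} (hq : 1 < q) {N : ℕ} (hN : ∀ k, N ≤ k → q * (n k : ℝ) ≤ n (k + 1)) {z ζ : ℂ}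
    (hz : z ∈ disc) (hζ : ζ ∈ disc) :
    ‖lacunarySum n z - lacunarySum n ζ‖ ≤
      2 * N + 8 + 2 * Real.log 8 / Real.log q + 4 / Real.log q * hypDist z ζ := by
  wlog h : ‖z‖ ≤ ‖ζ‖ generalizing z ζ
  · rw [norm_sub_rev, hypDist_comm]
    exact this hζ hz (le_of_not_ge h)
  obtain ⟨hs, hle⟩ := tsum_norm_pow_sub_pow_le hpos h2 hq hN h (mem_disc.1 hζ)
  refine le_trans ?_ hle
  exact ((hasSum_lacunarySum hpos h2 hz).sub (hasSum_lacunarySum hpos h2 hζ)).norm_le_of_bounded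
    hs.hasSum fun _ => le_rfl

theorem exists_norm_lacunarySum_sub_le (hpos : ∀ k, 0 < n k) (h2 : ∀ k, 2 * n k ≤ n (k + 1))
    (hlim : Filter.Tendsto (fun k => (n (k + 1) : ℝ) / (n k : ℝ)) Filter.atTop Filter.atTop)
    {ε : ℝ} (hε : 0 < ε) : ∃ C : ℝ, 0 < C ∧ ∀ z ∈ disc, ∀ ζ ∈ disc,
      ‖lacunarySum n z - lacunarySum n ζ‖ ≤ C + ε * hypDist z ζ := by
  -- This `q` makes the coefficient `4 / log q` equal to `ε`.
  have hq : 1 < Real.exp (4 / ε) := Real.one_lt_exp_iff.2 (by positivity)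
  obtain ⟨N, hN⟩ := Filter.eventually_atTop.1 (hlim.eventually_ge_atTop (Real.exp (4 / ε)))
  have h8 : 0 < Real.log 8 := Real.log_pos (by norm_num)
  refine ⟨2 * N + 8 + 2 * Real.log 8 / Real.log (Real.exp (4 / ε)), ?_, fun z hz ζ hζ => ?_⟩
  · rw [Real.log_exp]; positivity
  refine (norm_lacunarySum_sub_le hpos h2 hq (N := N) (fun k hk => ?_) hz hζ).trans_eq ?_
  · exact (le_div_iff₀ (by exact_mod_cast hpos k)).1 (hN k hk)
  · rw [Real.log_exp]
    have : 4 / (4 / ε) = ε := by field_simp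
    rw [this]

end Series

open Metric Real

/-! ### The subharmonic function `log (1 + |f|²)` -/

/-- The function `log (1 + |f|²)`. -/
noncomputable def logSize (f : ℂ → ℂ) (z : ℂ) : ℝ := Real.log (1 + ‖f z‖ ^ 2)

theorem logSize_nonneg (f : ℂ → ℂ) (z : ℂ) : 0 ≤ logSize f z :=
  Real.log_nonneg (by nlinarith [sq_nonneg ‖f z‖])

theorem continuousOn_logSize {f : ℂ → ℂ} {s : Set ℂ} (hf : ContinuousOn f s) :
    ContinuousOn (logSize f) s :=
  (continuousOn_const.add (hf.norm.pow 2)).log fun z _ => by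
    have := sq_nonneg ‖f z‖
    simp only [Pi.pow_apply, Pi.add_apply]
    positivity

theorem exp_neg_two_mul_logSize (f : ℂ → ℂ) (z : ℂ) :
    Real.exp (-2 * logSize f z) = ((1 + ‖f z‖ ^ 2) ^ 2)⁻¹ := by
  have h : (0 : ℝ) < 1 + ‖f z‖ ^ 2 := by positivity
  rw [logSize, neg_mul, Real.exp_neg, two_mul, Real.exp_add, Real.exp_log h, sq (1 + ‖f z‖ ^ 2)]

theorem norm_conj_mul_div_le {a d : ℂ} (hd : ‖d‖ ≤ 1) :
    ‖(starRingEnd ℂ) a * d / ((1 + ‖a‖ ^ 2 : ℝ) : ℂ)‖ ≤ 1 / 2 := by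
  have h : (0 : ℝ) < 1 + ‖a‖ ^ 2 := by positivity
  rw [norm_div, norm_mul, Complex.norm_conj, Complex.norm_real, Real.norm_of_nonneg h.le,
    div_le_iff₀ h]
  nlinarith [norm_nonneg a, norm_nonneg d, sq_nonneg (‖a‖ - 1)]

/-- From `(1 + |a|²)(1 + |b|²) = |1 + ā b|² + |b - a|²`. With `A = 1 + |a|²` and `1 + ā b = A (1 +
h)`, this reads `1 + |b|² = A |1 + h|² (1 + x)`. The factor `|1 + h|` has a logarithm harmonic in
`b` and will average out; `log (1 + x)` is the gain. -/
theorem log_one_add_sq_ge {a b : ℂ} (hab : ‖b - a‖ ≤ 1) :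
    Real.log (1 + ‖a‖ ^ 2) +
        2 * Real.log ‖1 + (starRingEnd ℂ) a * (b - a) / ((1 + ‖a‖ ^ 2 : ℝ) : ℂ)‖ +
        1 / 12 * ‖b - a‖ ^ 2 * ((1 + ‖a‖ ^ 2) ^ 2)⁻¹ ≤ Real.log (1 + ‖b‖ ^ 2) := by
  have hA : (0 : ℝ) < 1 + ‖a‖ ^ 2 := by positivity
  have hA1 : (1 : ℝ) ≤ 1 + ‖a‖ ^ 2 := by nlinarith [sq_nonneg ‖a‖]
  have hh := norm_conj_mul_div_le (a := a) hab
  have hAh : ((1 + ‖a‖ ^ 2 : ℝ) : ℂ) *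
      (1 + (starRingEnd ℂ) a * (b - a) / ((1 + ‖a‖ ^ 2 : ℝ) : ℂ)) = 1 + (starRingEnd ℂ) a * b := by
    have : ((1 + ‖a‖ ^ 2 : ℝ) : ℂ) ≠ 0 := by exact_mod_cast hA.ne'
    rw [mul_add, mul_div_cancel₀ _ this, mul_one, mul_sub, Complex.conj_mul']
    push_cast; ring
  have hid : (1 + ‖a‖ ^ 2) * (1 + ‖b‖ ^ 2) =
      ‖1 + (starRingEnd ℂ) a * b‖ ^ 2 + ‖b - a‖ ^ 2 := by
    simp only [← Complex.normSq_eq_norm_sq, Complex.normSq_apply]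
    simp
    ring
  rw [← hAh, norm_mul, Complex.norm_real, Real.norm_of_nonneg hA.le] at hid
  set h := (starRingEnd ℂ) a * (b - a) / ((1 + ‖a‖ ^ 2 : ℝ) : ℂ)
  set A := 1 + ‖a‖ ^ 2
  have hlow : 1 / 2 ≤ ‖1 + h‖ := by
    have := norm_sub_norm_le (1 : ℂ) (-h)
    rw [norm_one, norm_neg, sub_neg_eq_add] at this
    linarith
  have hup : ‖1 + h‖ ≤ 3 / 2 := by
    have := norm_add_le (1 : ℂ) h
    rw [norm_one] at this
    linarith
  set v := ‖1 + h‖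
  set δ := ‖b - a‖
  have hδ : 0 ≤ δ := norm_nonneg _
  have hv : 0 < v := by linarith
  set x := δ ^ 2 / (A * v) ^ 2 with hx
  have hx0 : 0 ≤ x := by positivity
  have hx4 : x ≤ 4 := by
    rw [hx, div_le_iff₀ (by positivity)]
    have h1 : 1 / 2 ≤ A * v := by nlinarith
    nlinarith
  have hxl : 4 / 9 * (δ ^ 2 * (A ^ 2)⁻¹) ≤ x := by
    rw [hx, mul_pow, ← div_eq_mul_inv, ← mul_div_assoc, div_le_div_iff₀ (by positivity)
      (by positivity)]
    have : v ^ 2 ≤ 9 / 4 := by nlinarith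
    have h3 : 0 ≤ δ ^ 2 * A ^ 2 := by positivity
    nlinarith
  have hb : 1 + ‖b‖ ^ 2 = A * v ^ 2 * (1 + x) := by
    have : A * (1 + ‖b‖ ^ 2) = A * (A * v ^ 2 * (1 + x)) := by
      rw [hid, hx]; field_simp
    exact mul_left_cancel₀ hA.ne' this
  -- `log (1 + x) ≥ x / (1 + x)` and `x ≤ 4`; with `hxl` the gain has constant `4 / 45 ≥ 1 / 12`.
  have hlogx : x / 5 ≤ Real.log (1 + x) := by
    refine le_trans ?_ (Real.one_sub_inv_le_log_of_pos (by linarith))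
    have : 1 - (1 + x)⁻¹ = x / (1 + x) := by field_simp; ring
    rw [this]
    gcongr
    linarith
  rw [hb, Real.log_mul (by positivity) (by positivity), Real.log_mul (by positivity)
    (by positivity), Real.log_pow]
  push_cast
  have : 0 ≤ δ ^ 2 * (A ^ 2)⁻¹ := by positivity
  linarith

/-- The derivative at the centre is the mean of the difference quotient, so `ρ |f'(c)|` is at most
the mean of `|f - f(c)|`; Cauchy–Schwarz then gives the square. -/
theorem sq_mul_norm_deriv_le_circleAverage {f : ℂ → ℂ} {c : ℂ} {ρ : ℝ} (hρ : 0 < ρ)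
    (hf : AnalyticOnNhd ℂ f (closedBall c ρ)) :
    (ρ * ‖deriv f c‖) ^ 2 ≤ circleAverage (fun w => ‖f w - f c‖ ^ 2) c ρ := by
  have hd : ∀ z ∈ closedBall c ρ, DifferentiableAt ℂ f z := fun z hz => (hf z hz).differentiableAt
  have hcont : ContinuousOn (dslope f c) (closedBall c ρ) := fun z hz => by
    by_cases h : z = c
    · subst h
      exact (continuousAt_dslope_same.2 (hd z hz)).continuousWithinAt
    · exact ((continuousAt_dslope_of_ne h).2 (hd z hz).continuousAt).continuousWithinAt
  have hmean : circleAverage (dslope f c) c ρ = deriv f c := by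
    rw [← dslope_same f c]
    refine circleAverage_of_differentiable_on_off_countable (s := {c}) (Set.countable_singleton c)
      (by rwa [abs_of_pos hρ]) fun z hz => ?_
    rw [abs_of_pos hρ] at hz
    exact (differentiableAt_dslope_of_ne hz.2).2 (hd z (ball_subset_closedBall hz.1))
  have hfc : ContinuousOn (fun w => ‖f w - f c‖) (closedBall c ρ) := fun z hz =>
    ((hd z hz).continuousAt.sub continuousAt_const).norm.continuousWithinAt
  have hint₁ : CircleIntegrable (fun w => ‖f w - f c‖) c ρ :=
    (hfc.mono sphere_subset_closedBall).circleIntegrable hρ.le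
  have hint₂ : CircleIntegrable (fun w => ‖f w - f c‖ ^ 2) c ρ :=
    ((hfc.mono sphere_subset_closedBall).pow 2).circleIntegrable hρ.le
  have h1 : ρ * ‖deriv f c‖ ≤ circleAverage (fun w => ‖f w - f c‖) c ρ := by
    have e : circleAverage (fun w => ‖f w - f c‖) c ρ =
        ρ * circleAverage (fun w => ‖dslope f c w‖) c ρ := by
      rw [← smul_eq_mul, ← circleAverage_fun_smul]
      refine circleAverage_congr_sphere fun w hw => ?_
      rw [abs_of_pos hρ, mem_sphere_iff_norm] at hw
      have hwc : w ≠ c := by rintro rfl; simp at hw; linarith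
      simp only [smul_eq_mul]
      rw [dslope_of_ne _ hwc, slope_def_field, norm_div, hw, mul_div_cancel₀ _ hρ.ne']
    rw [e, ← hmean]
    gcongr
    rw [circleAverage, circleAverage, norm_smul, smul_eq_mul,
      Real.norm_of_nonneg (by positivity)]
    gcongr
    exact intervalIntegral.norm_integral_le_integral_norm (by positivity)
  set a := ρ * ‖deriv f c‖
  have ha : 0 ≤ a := by positivity
  have hint₃ : CircleIntegrable (fun w => (2 * a) • ‖f w - f c‖) c ρ := hint₁.const_smul
  have h2 : circleAverage (fun w => (2 * a) • ‖f w - f c‖ - a ^ 2) c ρ ≤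
      circleAverage (fun w => ‖f w - f c‖ ^ 2) c ρ := by
    refine circleAverage_mono (hint₃.sub (circleIntegrable_const _ _ _)) hint₂
      fun w _ => ?_
    rw [smul_eq_mul]
    nlinarith [sq_nonneg (‖f w - f c‖ - a)]
  rw [circleAverage_fun_sub hint₃ (circleIntegrable_const _ _ _), circleAverage_const,
    circleAverage_fun_smul, smul_eq_mul] at h2
  nlinarith

/-- Average `log_one_add_sq_ge` with `a = f c`, `b = f w`. The auxiliary `G` is analytic and
zero-free with `G c = 1`, so `log |G|` has mean zero. -/
theorem logSize_add_le_circleAverage {f : ℂ → ℂ} {c : ℂ} {ρ : ℝ} (hρ : 0 < ρ)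
    (hf : AnalyticOnNhd ℂ f (closedBall c ρ)) (hosc : ∀ w ∈ closedBall c ρ, ‖f w - f c‖ ≤ 1) :
    logSize f c + 1 / 12 * (ρ * ‖deriv f c‖) ^ 2 * Real.exp (-2 * logSize f c) ≤
      circleAverage (logSize f) c ρ := by
  have hA : (0 : ℝ) < 1 + ‖f c‖ ^ 2 := by positivity
  have hρ' : |ρ| = ρ := abs_of_pos hρ
  set G : ℂ → ℂ := fun w =>
    1 + (starRingEnd ℂ) (f c) * (f w - f c) / ((1 + ‖f c‖ ^ 2 : ℝ) : ℂ) with hG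
  have hGan : AnalyticOnNhd ℂ G (closedBall c |ρ|) := by
    rw [hρ']
    exact analyticOnNhd_const.add ((analyticOnNhd_const.mul
      (hf.sub analyticOnNhd_const)).div_const)
  have hGne : ∀ w ∈ closedBall c |ρ|, G w ≠ 0 := by
    intro w hw h
    rw [hρ'] at hw
    have h1 := norm_conj_mul_div_le (a := f c) (hosc w hw)
    have h2 : (starRingEnd ℂ) (f c) * (f w - f c) / ((1 + ‖f c‖ ^ 2 : ℝ) : ℂ) = -1 :=
      (neg_eq_of_add_eq_zero_right h).symm
    rw [h2, norm_neg, norm_one] at h1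
    norm_num at h1
  have hmean := AnalyticOnNhd.circleAverage_log_norm_of_ne_zero hGan hGne
  have hGc : G c = 1 := by simp [hG]
  rw [hGc, norm_one, Real.log_one] at hmean
  have hfc : ContinuousOn f (sphere c ρ) := hf.continuousOn.mono sphere_subset_closedBall
  have hi₁ : CircleIntegrable (fun w => Real.log ‖G w‖) c ρ := by
    refine ContinuousOn.circleIntegrable' ((hGan.continuousOn.mono
      sphere_subset_closedBall).norm.log fun w hw => ?_)
    exact norm_ne_zero_iff.2 (hGne w (sphere_subset_closedBall hw))
  have hi₂ : CircleIntegrable (fun w => ‖f w - f c‖ ^ 2) c ρ :=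
    ((hfc.sub continuousOn_const).norm.pow 2).circleIntegrable hρ.le
  have hi₃ : CircleIntegrable (logSize f) c ρ := (continuousOn_logSize hfc).circleIntegrable hρ.le
  set κ : ℝ := 1 / 12 * Real.exp (-2 * logSize f c) with hκ
  have hκ0 : 0 ≤ κ := by positivity
  have hi₁' : CircleIntegrable (fun w => logSize f c + (2 : ℝ) • Real.log ‖G w‖) c ρ :=
    (circleIntegrable_const _ _ _).add hi₁.const_smul
  have hi₁'' : CircleIntegrable (fun w => (2 : ℝ) • Real.log ‖G w‖) c ρ := hi₁.const_smul
  have hi₂' : CircleIntegrable (fun w => κ • ‖f w - f c‖ ^ 2) c ρ := hi₂.const_smul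
  have hle : circleAverage (fun w => (logSize f c + (2 : ℝ) • Real.log ‖G w‖) +
      κ • ‖f w - f c‖ ^ 2) c ρ ≤ circleAverage (logSize f) c ρ := by
    refine circleAverage_mono (hi₁'.add hi₂') hi₃ fun w hw => ?_
    rw [hρ'] at hw
    have := log_one_add_sq_ge (hosc w (sphere_subset_closedBall hw))
    rw [hκ, exp_neg_two_mul_logSize, smul_eq_mul, smul_eq_mul]
    refine le_trans (le_of_eq ?_) this
    simp only [logSize, hG]
    ring
  rw [circleAverage_fun_add hi₁' hi₂',
    circleAverage_fun_add (circleIntegrable_const _ _ _) hi₁'', circleAverage_const,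
    circleAverage_fun_smul, circleAverage_fun_smul, hmean, smul_zero, add_zero,
    smul_eq_mul] at hle
  refine le_trans ?_ hle
  have h := mul_le_mul_of_nonneg_left (sq_mul_norm_deriv_le_circleAverage hρ hf) hκ0
  calc _ = logSize f c + κ * (ρ * ‖deriv f c‖) ^ 2 := by rw [hκ]; ring
    _ ≤ _ := by linarith

/-! ### Radial means -/

theorem circleAverage_zero_norm (u : ℂ → ℝ) (w : ℂ) :
    circleAverage u 0 ‖w‖ = (2 * π)⁻¹ • ∫ θ in 0..2 * π, u (circleMap 0 1 θ * w) := by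
  rw [circleAverage_eq_integral_add w.arg]
  congr 2 with θ
  congr 1
  conv_rhs => rw [← Complex.norm_mul_exp_arg_mul_I w]
  simp only [circleMap, zero_add, Complex.ofReal_add, add_mul, Complex.exp_add,
    Complex.ofReal_one, one_mul]
  ring

theorem intervalIntegral_swap {F : ℝ → ℝ → ℝ} (hF : Continuous (Function.uncurry F)) {a b : ℝ}
    (hab : a ≤ b) :
    ∫ x in a..b, ∫ y in a..b, F x y = ∫ y in a..b, ∫ x in a..b, F x y := by
  simp only [intervalIntegral.integral_of_le hab]
  refine MeasureTheory.integral_integral_swap ?_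
  rw [MeasureTheory.Measure.prod_restrict]
  exact (hF.continuousOn.integrableOn_compact (isCompact_Icc.prod isCompact_Icc)).mono_set
    (Set.prod_mono Set.Ioc_subset_Icc_self Set.Ioc_subset_Icc_self)

section Radial

variable {u : ℂ → ℝ} {r ρ : ℝ}

theorem circleMap_one_mul (θ φ : ℝ) :
    circleMap 0 1 θ * circleMap r ρ φ = circleMap (circleMap 0 r θ) ρ (φ + θ) := by
  simp only [circleMap, zero_add, Complex.ofReal_add, add_mul, Complex.exp_add,
    Complex.ofReal_one, one_mul]
  ring

theorem norm_circleMap_le (hr : 0 ≤ r) (hρ : 0 ≤ ρ) (φ : ℝ) : ‖circleMap r ρ φ‖ ≤ r + ρ := by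
  refine (norm_add_le _ _).trans_eq ?_
  simp [Complex.norm_exp_ofReal_mul_I, abs_of_nonneg hr, abs_of_nonneg hρ]

theorem circleMap_one_mul_mem_disc (hr : 0 ≤ r) (hρ : 0 ≤ ρ) (h : r + ρ < 1) (θ φ : ℝ) :
    circleMap 0 1 θ * circleMap r ρ φ ∈ disc := by
  rw [mem_disc, norm_mul, norm_circleMap_zero, abs_one, one_mul]
  exact (norm_circleMap_le hr hρ φ).trans_lt h

/-- The radial mean is an average of rotations of `u`; Fubini exchanges rotation with averaging over
the small circle. Local submean inequalities for `u` thus pass to its radial means. -/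
theorem circleAverage_circleAverage_norm (hu : ContinuousOn u disc) (hr : 0 ≤ r) (hρ : 0 ≤ ρ)
    (h : r + ρ < 1) :
    circleAverage (fun w => circleAverage u 0 ‖w‖) r ρ =
      circleAverage (fun z => circleAverage u z ρ) 0 r := by
  have hF : Continuous (Function.uncurry fun φ θ : ℝ => u (circleMap 0 1 θ * circleMap r ρ φ)) := by
    refine hu.comp_continuous (f := fun p : ℝ × ℝ => circleMap 0 1 p.2 * circleMap r ρ p.1)
      ?_ fun p => circleMap_one_mul_mem_disc hr hρ h _ _
    exact ((continuous_circleMap 0 1).comp continuous_snd).mul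
      ((continuous_circleMap r ρ).comp continuous_fst)
  have hl : circleAverage (fun w => circleAverage u 0 ‖w‖) r ρ =
      (2 * π)⁻¹ * ((2 * π)⁻¹ * ∫ φ in 0..2 * π, ∫ θ in 0..2 * π,
        u (circleMap 0 1 θ * circleMap r ρ φ)) := by
    rw [circleAverage, smul_eq_mul, ← intervalIntegral.integral_const_mul (2 * π)⁻¹ (fun φ : ℝ =>
      ∫ θ in 0..2 * π, u (circleMap 0 1 θ * circleMap r ρ φ))]
    simp only [circleAverage_zero_norm, smul_eq_mul]
  have hr' : circleAverage (fun z => circleAverage u z ρ) 0 r =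
      (2 * π)⁻¹ * ((2 * π)⁻¹ * ∫ θ in 0..2 * π, ∫ φ in 0..2 * π,
        u (circleMap 0 1 θ * circleMap r ρ φ)) := by
    rw [circleAverage, smul_eq_mul, ← intervalIntegral.integral_const_mul (2 * π)⁻¹ (fun θ : ℝ =>
      ∫ φ in 0..2 * π, u (circleMap 0 1 θ * circleMap r ρ φ))]
    congr 1
    refine intervalIntegral.integral_congr fun θ _ => ?_
    simp only [circleMap_one_mul]
    rw [circleAverage_eq_integral_add θ, smul_eq_mul]
  rw [hl, hr', intervalIntegral_swap hF (by positivity)]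

theorem continuous_circleAverage_center (hu : ContinuousOn u disc) (hr : 0 ≤ r) (hρ : 0 ≤ ρ)
    (h : r + ρ < 1) : Continuous fun θ => circleAverage u (circleMap 0 r θ) ρ := by
  refine (intervalIntegral.continuous_parametric_intervalIntegral_of_continuous' (f := fun θ φ =>
    u (circleMap (circleMap 0 r θ) ρ φ)) ?_ 0 (2 * π)).const_smul (2 * π)⁻¹
  refine hu.comp_continuous (f := fun p : ℝ × ℝ => circleMap (circleMap 0 r p.1) ρ p.2) ?_
    fun p => ?_
  · simp only [circleMap]; fun_prop
  · have := circleMap_one_mul_mem_disc hr hρ h p.1 (p.2 - p.1)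
    rwa [circleMap_one_mul, sub_add_cancel] at this

theorem continuousOn_circleAverage_zero (hu : ContinuousOn u disc) :
    ContinuousOn (circleAverage u 0) (Set.Ico 0 1) :=
  ContinuousOn.circleAverage (hu.mono fun z hz => mem_disc.2 (by simpa using hz.2))
    fun _ hr => hr.1

/-- Maximum principle for a radial function. -/
theorem le_of_le_circleAverage_norm {m : ℝ → ℝ} {R : ℝ} (hR : 0 ≤ R)
    (hm : ContinuousOn m (Set.Icc 0 R))
    (hsub : ∀ r, 0 ≤ r → r < R → ∃ η₀ > 0, ∀ η, 0 < η → η ≤ η₀ → r + η ≤ R →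
      m r ≤ circleAverage (fun w => m ‖w‖) r η) (hr : r ∈ Set.Icc 0 R) : m r ≤ m R := by
  obtain ⟨x₀, hx₀, hmax⟩ := isCompact_Icc.exists_isMaxOn ⟨R, hR, le_rfl⟩ hm
  have hcl : IsClosed (Set.Icc 0 R ∩ m ⁻¹' {m x₀}) :=
    hm.preimage_isClosed_of_isClosed isClosed_Icc isClosed_singleton
  -- `r₀` is the largest maximum point. If `r₀ < R`, a small circle about `r₀` contains `r₀ + η`,
  -- where `m` is strictly below its maximum, contradicting the submean inequality.
  obtain ⟨r₀, ⟨hr₀, hmr₀⟩, hub⟩ :=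
    (isCompact_Icc.of_isClosed_subset hcl Set.inter_subset_left).exists_isGreatest ⟨x₀, hx₀, rfl⟩
  simp only [Set.mem_preimage, Set.mem_singleton_iff] at hmr₀
  rcases hr₀.2.eq_or_lt with h | h
  · rw [← h, hmr₀]; exact hmax hr
  exfalso
  obtain ⟨η₀, hη₀, hη⟩ := hsub r₀ hr₀.1 h
  set η := min η₀ (R - r₀)
  have hηpos : 0 < η := lt_min hη₀ (by linarith)
  have hηR : r₀ + η ≤ R := by linarith [min_le_right η₀ (R - r₀)]
  have hmem : ∀ φ, ‖circleMap r₀ η φ‖ ∈ Set.Icc 0 R := fun φ =>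
    ⟨norm_nonneg _, (norm_circleMap_le hr₀.1 hηpos.le φ).trans hηR⟩
  have hc : Continuous fun φ => m ‖circleMap r₀ η φ‖ :=
    hm.comp_continuous (continuous_circleMap _ _).norm hmem
  have hlt : ∫ φ in 0..2 * π, m ‖circleMap r₀ η φ‖ < ∫ _ in 0..2 * π, m x₀ := by
    refine intervalIntegral.integral_lt_integral_of_continuousOn_of_le_of_exists_lt (by positivity)
      hc.continuousOn continuousOn_const (fun φ _ => hmax (hmem φ)) ⟨0, ⟨le_rfl, by positivity⟩, ?_⟩
    have e : ‖circleMap r₀ η 0‖ = r₀ + η := by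
      have : circleMap r₀ η 0 = ((r₀ + η : ℝ) : ℂ) := by simp [circleMap]
      rw [this, Complex.norm_real, Real.norm_of_nonneg (by linarith [hr₀.1])]
    refine lt_of_le_of_ne (hmax (hmem 0)) fun he => ?_
    have := hub ⟨hmem 0, he⟩
    rw [e] at this
    linarith
  have h1 := hη η hηpos (min_le_left _ _) hηR
  rw [hmr₀, circleAverage, smul_eq_mul, ← div_eq_inv_mul, le_div_iff₀ (by positivity)] at h1
  rw [intervalIntegral.integral_const, smul_eq_mul, sub_zero] at hlt
  linarith

end Radial

/-! ### Growth of the radial means of `log (1 + |f|²)` for a Bloch function -/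

section Bloch

variable {f : ℂ → ℂ} {κ : ℝ}

/-- Within distance `(1 - |z|) / 2` of `z` the derivative is at most `2 L / (1 - |z|)`, so `κ = 1 /
(2 L)` works. -/
theorem exists_osc_le_one {K : ℝ} (hf : DifferentiableOn ℂ f disc)
    (hK : ∀ z ∈ disc, (1 - ‖z‖) * ‖deriv f z‖ ≤ K) :
    ∃ κ : ℝ, 0 < κ ∧ κ ≤ 1 / 2 ∧
      ∀ z ∈ disc, ∀ w ∈ closedBall z (κ * (1 - ‖z‖)), ‖f w - f z‖ ≤ 1 := by
  set L := max K 1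
  have hL : 1 ≤ L := le_max_right _ _
  refine ⟨1 / (2 * L), by positivity, ?_, fun z hz w hw => ?_⟩
  · rw [div_le_div_iff₀ (by positivity) (by norm_num)]; linarith
  have ht : 0 < 1 - ‖z‖ := by have := mem_disc.1 hz; linarith
  have hκ : 1 / (2 * L) ≤ 1 / 2 := by
    rw [div_le_div_iff₀ (by positivity) (by norm_num)]; linarith
  have hhalf : ∀ v ∈ closedBall z (1 / (2 * L) * (1 - ‖z‖)), (1 - ‖z‖) / 2 ≤ 1 - ‖v‖ := by
    intro v hv
    rw [mem_closedBall_iff_norm] at hv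
    have h1 := norm_sub_norm_le v z
    have h2 : 1 / (2 * L) * (1 - ‖z‖) ≤ 1 / 2 * (1 - ‖z‖) := by gcongr
    linarith
  have hvd : ∀ v ∈ closedBall z (1 / (2 * L) * (1 - ‖z‖)), v ∈ disc := fun v hv => by
    have := hhalf v hv
    rw [mem_disc]
    linarith
  have hder : ∀ v ∈ closedBall z (1 / (2 * L) * (1 - ‖z‖)), ‖deriv f v‖ ≤ 2 * L / (1 - ‖z‖) := by
    intro v hv
    have h1 := hhalf v hv
    have h2 := (hK v (hvd v hv)).trans (le_max_left K 1)
    rw [le_div_iff₀ ht]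
    nlinarith [norm_nonneg (deriv f v)]
  have h := (convex_closedBall z (1 / (2 * L) * (1 - ‖z‖))).norm_image_sub_le_of_norm_deriv_le
    (𝕜 := ℂ) (fun v hv => (hf.differentiableAt (isOpen_disc.mem_nhds (hvd v hv)))) hder
    (mem_closedBall_self (by positivity)) hw
  refine h.trans ?_
  rw [mem_closedBall_iff_norm] at hw
  calc _ ≤ 2 * L / (1 - ‖z‖) * (1 / (2 * L) * (1 - ‖z‖)) := by gcongr
    _ = 1 := by field_simp

theorem closedBall_subset_disc {z : ℂ} {ρ : ℝ} (h : ‖z‖ + ρ < 1) : closedBall z ρ ⊆ disc := by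
  intro w hw
  rw [mem_closedBall_iff_norm] at hw
  have := norm_sub_norm_le w z
  rw [mem_disc]
  linarith

theorem circleAverage_logSize_add_le (hf : DifferentiableOn ℂ f disc)
    (hosc : ∀ z ∈ disc, ∀ w ∈ closedBall z (κ * (1 - ‖z‖)), ‖f w - f z‖ ≤ 1)
    {r ρ : ℝ} (hr : 0 ≤ r) (hρ : 0 < ρ) (h : r + ρ < 1) (hρκ : ρ ≤ κ * (1 - r)) {a B : ℝ}
    (ha : 0 ≤ a) (hder : ∀ z, ‖z‖ = r → a ≤ ρ * ‖deriv f z‖)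
    (hB : circleAverage (logSize f) 0 r ≤ B) :
    circleAverage (logSize f) 0 r + 1 / 12 * a ^ 2 * Real.exp (-2 * B) ≤
      circleAverage (fun w => circleAverage (logSize f) 0 ‖w‖) r ρ := by
  have hu : ContinuousOn (logSize f) disc := continuousOn_logSize hf.continuousOn
  rw [circleAverage_circleAverage_norm hu hr hρ.le h]
  set c : ℝ := 1 / 12 * a ^ 2 * Real.exp (-2 * B) with hc
  have hc0 : 0 ≤ c := by positivity
  have hi₁ : CircleIntegrable (logSize f) 0 r := by
    refine (hu.mono fun z hz => ?_).circleIntegrable hr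
    rw [mem_disc, mem_sphere_zero_iff_norm.1 hz]
    linarith
  have hi₂ : CircleIntegrable (fun z => circleAverage (logSize f) z ρ) 0 r :=
    (continuous_circleAverage_center hu hr hρ.le h).intervalIntegrable _ _
  have hi₁' : CircleIntegrable (fun z => (1 - 2 * c) • logSize f z) 0 r := hi₁.const_smul
  have hle : circleAverage (fun z => c * (1 + 2 * B) + (1 - 2 * c) • logSize f z) 0 r ≤
      circleAverage (fun z => circleAverage (logSize f) z ρ) 0 r := by
    refine circleAverage_mono ((circleIntegrable_const _ _ _).add hi₁') hi₂
      fun z hz => ?_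
    rw [abs_of_nonneg hr, mem_sphere_zero_iff_norm] at hz
    have hzd : z ∈ disc := by rw [mem_disc, hz]; linarith
    have h1 := logSize_add_le_circleAverage hρ
      ((hf.analyticOnNhd isOpen_disc).mono (closedBall_subset_disc (by rwa [hz])))
      fun w hw => hosc z hzd w (closedBall_subset_closedBall (by rwa [hz]) hw)
    refine le_trans ?_ h1
    have h2 : a ^ 2 ≤ (ρ * ‖deriv f z‖) ^ 2 := by
      have := hder z hz
      gcongr
    -- Jensen's inequality by hand: the tangent line of `x ↦ e^{-2x}` at `B` lies below the graph.
    -- After averaging, the linear term is harmless because the mean is at most `B`.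
    have h3 : Real.exp (-2 * B) * (1 + 2 * B - 2 * logSize f z) ≤
        Real.exp (-2 * logSize f z) := by
      have h4 := Real.add_one_le_exp (2 * B - 2 * logSize f z)
      calc _ ≤ Real.exp (-2 * B) * Real.exp (2 * B - 2 * logSize f z) := by
            gcongr; linarith
        _ = _ := by rw [← Real.exp_add]; ring_nf
    calc c * (1 + 2 * B) + (1 - 2 * c) • logSize f z
        = logSize f z + 1 / 12 * a ^ 2 *
          (Real.exp (-2 * B) * (1 + 2 * B - 2 * logSize f z)) := by
          rw [hc, smul_eq_mul]; ring
      _ ≤ logSize f z + 1 / 12 * a ^ 2 * Real.exp (-2 * logSize f z) := by gcongr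
      _ ≤ _ := by gcongr
  refine le_trans ?_ hle
  rw [circleAverage_fun_add (circleIntegrable_const _ _ _) hi₁', circleAverage_const,
    circleAverage_fun_smul, smul_eq_mul]
  nlinarith

theorem circleAverage_logSize_mono (hf : DifferentiableOn ℂ f disc) (hκ : 0 < κ)
    (hosc : ∀ z ∈ disc, ∀ w ∈ closedBall z (κ * (1 - ‖z‖)), ‖f w - f z‖ ≤ 1) :
    MonotoneOn (circleAverage (logSize f) 0) (Set.Ico 0 1) := by
  intro r hr R hR hrR
  have hu : ContinuousOn (logSize f) disc := continuousOn_logSize hf.continuousOn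
  refine le_of_le_circleAverage_norm hR.1 ((continuousOn_circleAverage_zero hu).mono fun x hx =>
    ⟨hx.1, hx.2.trans_lt hR.2⟩) (fun x hx hxR => ?_) ⟨hr.1, hrR⟩
  refine ⟨κ * (1 - x), mul_pos hκ (by linarith [hR.2]), fun η hη hηκ hxη => ?_⟩
  -- Here `a = 0`: only the plain submean inequality is needed.
  have := circleAverage_logSize_add_le hf hosc hx hη (hxη.trans_lt hR.2) hηκ le_rfl
    (fun z _ => by positivity) le_rfl
  simpa using this

theorem circleAverage_logSize_gain (hf : DifferentiableOn ℂ f disc) (hκ : 0 < κ)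
    (hκ' : κ ≤ 1 / 2)
    (hosc : ∀ z ∈ disc, ∀ w ∈ closedBall z (κ * (1 - ‖z‖)), ‖f w - f z‖ ≤ 1)
    {r a B : ℝ} (hr : 0 ≤ r) (hr1 : r < 1) (ha : 0 ≤ a)
    (hder : ∀ z, ‖z‖ = r → a ≤ (1 - ‖z‖) * ‖deriv f z‖)
    (hB : circleAverage (logSize f) 0 r ≤ B) :
    circleAverage (logSize f) 0 r + 1 / 12 * (κ * a) ^ 2 * Real.exp (-2 * B) ≤
      circleAverage (logSize f) 0 ((1 + r) / 2) := by
  have ht : 0 < 1 - r := by linarith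
  have hρ : 0 < κ * (1 - r) := mul_pos hκ ht
  -- The small circle stays in `|w| ≤ (1 + r) / 2`, so monotonicity replaces its average by the
  -- value at that radius.
  have hρ' : r + κ * (1 - r) ≤ (1 + r) / 2 := by nlinarith
  have hu : ContinuousOn (logSize f) disc := continuousOn_logSize hf.continuousOn
  refine (circleAverage_logSize_add_le hf hosc hr hρ (by linarith) le_rfl (a := κ * a)
    (by positivity) (fun z hz => ?_) hB).trans ?_
  · have := hder z hz
    rw [hz] at this
    rw [mul_assoc]
    gcongr
  · have hmem : ∀ w ∈ sphere (r : ℂ) |κ * (1 - r)|, ‖w‖ ≤ (1 + r) / 2 := fun w hw => by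
      rw [abs_of_pos hρ, mem_sphere_iff_norm] at hw
      have := norm_sub_norm_le w r
      rw [Complex.norm_real, Real.norm_of_nonneg hr] at this
      linarith
    refine circleAverage_mono_on_of_le_circle ?_ fun w hw => ?_
    · refine ContinuousOn.circleIntegrable' ((continuousOn_circleAverage_zero hu).comp
        continuous_norm.continuousOn fun w hw => ⟨norm_nonneg w, ?_⟩)
      exact (hmem w hw).trans_lt (by linarith)
    · exact circleAverage_logSize_mono hf hκ hosc ⟨norm_nonneg w, (hmem w hw).trans_lt (by linarith)⟩
        ⟨by linarith, by linarith⟩ (hmem w hw)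

end Bloch

/-! ### Hardy space functions -/

theorem log_one_add_sq_le {x q : ℝ} (hx : 0 ≤ x) (hq : 0 < q) :
    Real.log (1 + x ^ 2) ≤ 1 + 2 / q * x ^ q := by
  have hxq : 0 ≤ 2 / q * x ^ q := by positivity
  rcases le_or_gt x 1 with h | h
  · have := Real.log_le_sub_one_of_pos (x := 1 + x ^ 2) (by positivity)
    nlinarith
  · have h1 : Real.log (1 + x ^ 2) ≤ Real.log (2 * x ^ 2) :=
      Real.log_le_log (by positivity) (by nlinarith)
    rw [Real.log_mul (by norm_num) (by positivity), Real.log_pow] at h1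
    have h2 := Real.log_le_rpow_div hx hq
    have h3 := Real.log_two_lt_d9
    have h4 : 2 / q * x ^ q = 2 * (x ^ q / q) := by ring
    push_cast at h1
    linarith

/-- The only use of membership in `H^p`: the logarithm grows more slowly than every positive power,
so all `p` are treated alike. -/
theorem exists_circleAverage_logSize_le {p : ℝ≥0∞} (hp : 0 < p) {f : ℂ → ℂ}
    (hf : f ∈ hardySpace p) :
    ∃ B : ℝ, ∀ r ∈ Set.Ioo (0 : ℝ) 1, circleAverage (logSize f) 0 r ≤ B := by
  obtain ⟨hd, hmean⟩ := hf
  have hu : ContinuousOn (logSize f) disc := continuousOn_logSize hd.continuousOn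
  have hmem : ∀ r ∈ Set.Ioo (0 : ℝ) 1, ∀ z ∈ sphere (0 : ℂ) |r|, z ∈ disc := fun r hr z hz => by
    rw [mem_sphere_zero_iff_norm, abs_of_pos hr.1] at hz
    rw [mem_disc, hz]; exact hr.2
  have hint : ∀ r ∈ Set.Ioo (0 : ℝ) 1, CircleIntegrable (logSize f) 0 r := fun r hr =>
    (hu.mono (hmem r hr)).circleIntegrable'
  split_ifs at hmean with hp'
  · obtain ⟨M, hM⟩ := hmean
    refine ⟨Real.log (1 + M ^ 2), fun r hr =>
      circleAverage_mono_on_of_le_circle (hint r hr) fun z hz => ?_⟩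
    have := hM z (hmem r hr z hz)
    exact Real.log_le_log (by positivity) (by gcongr)
  · set q := p.toReal
    have hq : 0 < q := ENNReal.toReal_pos hp.ne' hp'
    set S := ⨆ r ∈ Set.Ioo (0 : ℝ) 1,
      ∫⁻ θ in Set.Ioc (0 : ℝ) (2 * π), ‖f (circleMap 0 r θ)‖ₑ ^ q
    set T : ℝ≥0∞ := MeasureTheory.volume (Set.Ioc (0 : ℝ) (2 * π)) + ENNReal.ofReal (2 / q) * S
    have hT : T ≠ ∞ := ENNReal.add_ne_top.2
      ⟨measure_Ioc_lt_top.ne, ENNReal.mul_ne_top ENNReal.ofReal_ne_top hmean.ne⟩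
    refine ⟨(2 * π)⁻¹ * T.toReal, fun r hr => ?_⟩
    rw [circleAverage, smul_eq_mul]
    gcongr
    rw [intervalIntegral.integral_of_le (by positivity)]
    have hi : MeasureTheory.Integrable (fun θ => logSize f (circleMap 0 r θ))
        (MeasureTheory.volume.restrict (Set.Ioc (0 : ℝ) (2 * π))) :=
      (intervalIntegrable_iff_integrableOn_Ioc_of_le (by positivity)).1 (hint r hr)
    rw [← ENNReal.ofReal_le_iff_le_toReal hT, MeasureTheory.ofReal_integral_eq_lintegral_ofReal hi
      (Filter.Eventually.of_forall fun θ => logSize_nonneg _ _)]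
    calc ∫⁻ θ in Set.Ioc (0 : ℝ) (2 * π), ENNReal.ofReal (logSize f (circleMap 0 r θ))
        ≤ ∫⁻ θ in Set.Ioc (0 : ℝ) (2 * π),
            (1 + ENNReal.ofReal (2 / q) * ‖f (circleMap 0 r θ)‖ₑ ^ q) := by
          refine MeasureTheory.lintegral_mono fun θ => ?_
          refine (ENNReal.ofReal_le_ofReal (log_one_add_sq_le (norm_nonneg _) hq)).trans_eq ?_
          rw [ENNReal.ofReal_add (by norm_num) (by positivity), ENNReal.ofReal_one,
            ENNReal.ofReal_mul (by positivity),
            ← ENNReal.ofReal_rpow_of_nonneg (norm_nonneg _) hq.le, ofReal_norm]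
      _ = MeasureTheory.volume (Set.Ioc (0 : ℝ) (2 * π)) + ENNReal.ofReal (2 / q) *
            ∫⁻ θ in Set.Ioc (0 : ℝ) (2 * π), ‖f (circleMap 0 r θ)‖ₑ ^ q := by
          rw [MeasureTheory.lintegral_add_left measurable_const,
            MeasureTheory.lintegral_const_mul' _ _ ENNReal.ofReal_ne_top]
          simp
      _ ≤ MeasureTheory.volume (Set.Ioc (0 : ℝ) (2 * π)) + ENNReal.ofReal (2 / q) * S := by
          gcongr
          exact le_iSup₂_of_le (f := fun (r : ℝ) (_ : r ∈ Set.Ioo (0 : ℝ) 1) =>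
            ∫⁻ θ in Set.Ioc (0 : ℝ) (2 * π), ‖f (circleMap 0 r θ)‖ₑ ^ q) r hr le_rfl

/-! ### Distance from the series to the Hardy spaces -/

theorem ofReal_le_blochSeminorm (h : ℂ → ℂ) {z : ℂ} (hz : z ∈ disc) :
    ENNReal.ofReal ((1 - ‖z‖ ^ 2) * ‖deriv h z‖) ≤ blochSeminorm h :=
  le_iSup₂_of_le (f := fun (z : ℂ) (_ : z ∈ disc) =>
    ENNReal.ofReal ((1 - ‖z‖ ^ 2) * ‖deriv h z‖)) z hz le_rfl

theorem one_sub_mul_le_one_sub_sq_mul {z : ℂ} (hz : z ∈ disc) {x : ℝ} (hx : 0 ≤ x) :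
    (1 - ‖z‖) * x ≤ (1 - ‖z‖ ^ 2) * x := by
  have := mem_disc.1 hz
  gcongr
  nlinarith [norm_nonneg z]

theorem one_sub_mul_norm_deriv_le {f : ℂ → ℂ} (hf : f ∈ blochSpace) {z : ℂ} (hz : z ∈ disc) :
    (1 - ‖z‖) * ‖deriv f z‖ ≤ (blochSeminorm f).toReal :=
  (one_sub_mul_le_one_sub_sq_mul hz (norm_nonneg _)).trans
    ((ENNReal.ofReal_le_iff_le_toReal hf.2.ne).1 (ofReal_le_blochSeminorm f hz))

theorem lacunarySum_notMem_blochClosure {n : ℕ → ℕ} (hpos : ∀ k, 0 < n k)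
    (h2 : ∀ k, 2 * n k ≤ n (k + 1))
    (hlim : Filter.Tendsto (fun k => (n (k + 1) : ℝ) / (n k : ℝ)) Filter.atTop Filter.atTop)
    {p : ℝ≥0∞} (hp : 0 < p) : lacunarySum n ∉ blochClosure (hardySpace p ∩ blochSpace) := by
  rintro ⟨_, happrox⟩
  obtain ⟨f, ⟨hfH, hfB⟩, hfg⟩ := happrox (1 / 8) (by norm_num)
  have hfd : DifferentiableOn ℂ f disc := hfB.1
  obtain ⟨B, hB⟩ := exists_circleAverage_logSize_le hp hfH
  obtain ⟨κ, hκ, hκ', hosc⟩ :=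
    exists_osc_le_one hfd fun z hz => one_sub_mul_norm_deriv_le hfB hz
  have hmono := circleAverage_logSize_mono hfd hκ hosc
  set m := circleAverage (logSize f) 0
  obtain ⟨N, hN⟩ := Filter.eventually_atTop.1 (hlim.eventually_ge_atTop 140)
  have hratio : ∀ k, N ≤ k → 140 * (n k : ℝ) ≤ n (k + 1) := fun k hk =>
    (le_div_iff₀ (by exact_mod_cast hpos k)).1 (hN k hk)
  set r : ℕ → ℝ := fun k => 1 - 1 / n (k + 1) with hr_def
  have hn2 : ∀ k, (2 : ℝ) ≤ n (k + 1) := fun k => by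
    have := h2 k
    have := hpos k
    exact_mod_cast (by omega : 2 ≤ n (k + 1))
  have hr : ∀ k, r k ∈ Set.Ioo (0 : ℝ) 1 := fun k => by
    have h := hn2 k
    have h1 : 1 / (n (k + 1) : ℝ) ≤ 1 / 2 := by gcongr
    have h3 : 0 < 1 / (n (k + 1) : ℝ) := by positivity
    simp only [hr_def, Set.mem_Ioo]
    constructor <;> linarith
  have hder : ∀ k, N ≤ k → ∀ z : ℂ, ‖z‖ = r k → 1 / 8 ≤ (1 - ‖z‖) * ‖deriv f z‖ := by
    intro k hk z hz
    have hzd : z ∈ disc := by rw [mem_disc, hz]; exact (hr k).2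
    have hg := le_norm_deriv_lacunarySum hpos h2 (hratio k hk) (hratio (k + 1) (by omega)) hz
    have hlt := (ofReal_le_blochSeminorm (fun z => lacunarySum n z - f z) hzd).trans_lt hfg
    rw [ENNReal.ofReal_lt_ofReal_iff (by norm_num)] at hlt
    have hle := (one_sub_mul_le_one_sub_sq_mul hzd
      (norm_nonneg (deriv (fun z => lacunarySum n z - f z) z))).trans hlt.le
    rw [deriv_fun_sub (differentiableAt_lacunarySum hpos h2 hzd).1
      (hfd.differentiableAt (isOpen_disc.mem_nhds hzd))] at hle
    have htri := norm_sub_norm_le (deriv (lacunarySum n) z) (deriv f z)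
    have ht : 0 < 1 - ‖z‖ := by have := mem_disc.1 hzd; linarith
    nlinarith
  set δ : ℝ := 1 / 12 * (κ * (1 / 8)) ^ 2 * Real.exp (-2 * B) with hδ
  have hδ0 : 0 < δ := by positivity
  -- Doubling of the exponents gives `(1 + r_k) / 2 ≤ r_{k+1}`, so the gain at `r_k` is complete
  -- before the next circle.
  have hstep : ∀ k, N ≤ k → m (r k) + δ ≤ m (r (k + 1)) := by
    intro k hk
    have h1 := circleAverage_logSize_gain hfd hκ hκ' hosc (hr k).1.le (hr k).2 (by norm_num)
      (hder k hk) (hB _ (hr k))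
    refine h1.trans (hmono ⟨?_, ?_⟩ ⟨(hr _).1.le, (hr _).2⟩ ?_)
    · linarith [(hr k).1]
    · linarith [(hr k).2]
    · have h3 : (2 : ℝ) * n (k + 1) ≤ n (k + 2) := by exact_mod_cast h2 (k + 1)
      have hn := hn2 k
      have h4 : 1 / (n (k + 2) : ℝ) ≤ 1 / (2 * n (k + 1)) := by gcongr
      have h5 : 1 / (2 * (n (k + 1) : ℝ)) = 1 / (n (k + 1) : ℝ) / 2 := by field_simp
      change (1 + (1 - 1 / (n (k + 1) : ℝ))) / 2 ≤ 1 - 1 / (n (k + 2) : ℝ)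
      linarith
  have hsteps : ∀ j : ℕ, m (r N) + j * δ ≤ m (r (N + j)) := by
    intro j
    induction j with
    | zero => simp
    | succ j ih =>
      have := hstep (N + j) (by omega)
      push_cast
      rw [← add_assoc N j 1]
      linarith
  obtain ⟨j, hj⟩ := exists_nat_gt ((B - m (r N)) / δ)
  rw [div_lt_iff₀ hδ0] at hj
  linarith [hsteps j, hB _ (hr (N + j))]

/-! ### Factorial exponents -/

theorem two_mul_factorial_le (k : ℕ) : 2 * (k + 1).factorial ≤ (k + 1 + 1).factorial := by
  rw [Nat.factorial_succ (k + 1)]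
  exact Nat.mul_le_mul_right _ (by omega)

theorem factorial_ratio (k : ℕ) :
    ((k + 1 + 1).factorial : ℝ) / ((k + 1).factorial : ℝ) = (k : ℝ) + 2 := by
  have : ((k + 1).factorial : ℝ) ≠ 0 := by exact_mod_cast (k + 1).factorial_ne_zero
  rw [Nat.factorial_succ (k + 1), Nat.cast_mul, mul_div_cancel_right₀ _ this]
  push_cast; ring

theorem tendsto_factorial_ratio :
    Filter.Tendsto (fun k : ℕ => ((k + 1 + 1).factorial : ℝ) / ((k + 1).factorial : ℝ))
      Filter.atTop Filter.atTop := by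
  simp_rw [factorial_ratio]
  exact Filter.tendsto_atTop_add_const_right _ _ tendsto_natCast_atTop_atTop

end BlochClosure

open BlochClosure in
theorem mainTheorem4 :
    ∃ (g : ℂ → ℂ) (a : ℕ → ℂ) (n : ℕ → ℕ),
      IsLacunarySeries a n g ∧
      (∃ M : ℝ, ∀ k, ‖a k‖ ≤ M) ∧
      ¬ Filter.Tendsto a Filter.atTop (nhds 0) ∧
      Filter.Tendsto (fun k => (n (k + 1) : ℝ) / (n k : ℝ)) Filter.atTop Filter.atTop ∧
      g ∈ blochSpace ∧
      (∀ ε : ℝ, 0 < ε → ∃ C : ℝ, 0 < C ∧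
        ∀ z ∈ disc, ∀ ζ ∈ disc, ‖g z - g ζ‖ ≤ C + ε * hypDist z ζ) ∧
      ∀ p : ℝ≥0∞, 0 < p → g ∉ blochClosure (hardySpace p ∩ blochSpace) := by
  have hpos : ∀ k : ℕ, 0 < (k + 1).factorial := fun k => Nat.factorial_pos _
  have h2 := two_mul_factorial_le
  have hlim := tendsto_factorial_ratio
  -- The shift avoids `0! = 1!`, which would break doubling.
  refine ⟨lacunarySum fun k => (k + 1).factorial, fun _ => 1, fun k => (k + 1).factorial,
    ⟨hpos, ⟨2, by norm_num, fun k => by exact_mod_cast h2 k⟩, fun z hz => ?_⟩,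
    ⟨1, fun k => by simp⟩, fun h => ?_, hlim, lacunarySum_mem_blochSpace hpos h2,
    fun ε hε => exists_norm_lacunarySum_sub_le hpos h2 hlim hε,
    fun p hp => lacunarySum_notMem_blochClosure hpos h2 hlim hp⟩
  · simpa using hasSum_lacunarySum hpos h2 hz
  · exact one_ne_zero (tendsto_nhds_unique tendsto_const_nhds h)
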